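/- Let $q$ be a prime power and let $G$ be a group isomorphic to $\mathrm{PSL}_2(q)$, the projective special linear group of degree $2$ over the finite field with $q$ elements. Let $(\rho_0,\rho_1,\rho_2,\rho_3)$ be a string representation of $G$ of rank $4$, that is, a $4$-tuple of pairwise distinct elements of order $2$ which generate $G$ and satisfy $\rho_i\rho_j=\rho_j\rho_i$ whenever $|i-j|>1$. Then the facet group $G_3=\langle\rho_0,\rho_1,\rho_2\rangle$ is isomorphic to $\mathrm{S}_4$, to $\mathrm{A}_5$ or to $G$. Likewise the vertex group $G_0=\langle\rho_1,\rho_2,\rho_3\rangle$ is isomorphic to $\mathrm{S}_4$, to $\mathrm{A}_5$ or to $G$. -/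

import Mathlib

/-- `ρ = (ρ 0, …, ρ (n - 1))` is a *string representation of rank `n`* of the group `G`:
the `ρ i` are pairwise distinct involutions (elements of order exactly two) that generate `G`,
and `ρ i` commutes with `ρ j` whenever `|i - j| > 1`. -/
structure IsStringRepresentation {G : Type*} [Group G] {n : ℕ} (ρ : Fin n → G) : Prop where
  orderOf_eq_two : ∀ i, orderOf (ρ i) = 2
  injective : Function.Injective ρ
  commute : ∀ i j : Fin n, 1 < |(i : ℤ) - (j : ℤ)| → ρ i * ρ j = ρ j * ρ i
  closure_eq_top : Subgroup.closure (Set.range ρ) = ⊤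

/-- The subgroup `G_i = ⟨ρ j | j ≠ i⟩`. For `i = 0` this is the *vertex group* and for
`i = n - 1` the *facet group*. -/
def faceGroup {G : Type*} [Group G] {n : ℕ} (ρ : Fin n → G) (i : Fin n) : Subgroup G :=
  Subgroup.closure {g : G | ∃ j : Fin n, j ≠ i ∧ ρ j = g}

/-!
The proof follows Dickson's determination of the subgroups of `PSL₂(q)`, carried out only as far as
the facet group `H = ⟨ρ₀, ρ₁, ρ₂⟩` needs. If `ρ₃ ∈ H`, then `H = G`; suppose that `ρ₃ ∉ H`, and let
`F` be an algebraic closure of `K`.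

*What the string condition gives.* The involution `ρ₃` commutes with `ρ₀` and `ρ₁`, and these do not
commute, because the centre of `PSL₂(K)` is trivial. In characteristic two commuting is transitive
on non-trivial elements, so the characteristic is odd (`IsStringRepresentation.two_ne_zero`).
Involutions then lift to traceless matrices, distinct commuting involutions to anticommuting ones,
and a traceless matrix anticommuting with `A` and `B` is a multiple of `A * B - B * A`; so `ρ₃` is
the only involution commuting with `ρ₀` and `ρ₁` (`IsStringRepresentation.eq_three`). Hence no
involution of `H` commutes with both, which is recorded in `IsStringTriple`, and `ρ₀ * ρ₁` has odd
order (`IsStringRepresentation.odd_orderOf_mul`).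

*Classification of `H`.* The group `H` acts on the projective line over `F`, and each non-trivial
element has one or two fixed points. Burnside's lemma, applied to the points with non-trivial
stabilizer, leaves few possibilities (`IsParabolicSystem.classification_of_tame` and
`IsParabolicSystem.classification_of_wild`): a global fixed point, an abelian subgroup of index two,
order `12`, `24` or `60`, or an orbit that is a projective line over a finite subfield `k`
(`ActsByMoebius.exists_subfield`). The string condition excludes the first two and order `12`. For
order `24` the action on the four cosets of `⟨ρ₀, ρ₁⟩` identifies `H` with `S₄`, and for order `60`
the action on the five conjugates of `⟨ρ₀, ρ₂⟩` identifies it with `A₅`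
(`IsStringTriple.classification`).

*The subfield case.* In coordinates in which the invariant line is the one over `k`, elements of `H`
are given by multiples of matrices over `k`. So is `ρ₃`, which lifts to a multiple of a commutator,
and therefore so is every element of `G`. Thus `k` contains the squares of the traces of all
elements of `SL₂(K)`, that is, the squares of all elements of `K`, and so it contains `K`. But `|H|`
is at least the order of `PSL₂(k)`, so `H = G`, contrary to `ρ₃ ∉ H`.

The vertex group is the facet group of the reversed tuple.
-/

/-! ### Counting orbits of points with non-trivial stabilizer -/

section

open MulAction

/-- The features of a finite group `H` of Möbius transformations in characteristic `p` that the
classification uses. Every non-trivial element has one or two fixed points. The subgroup `U y`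
consists of the identity and of the elements whose only fixed point is `y` (the translations, if `y`
is placed at infinity). If `U y` is non-trivial, its order is divisible by `p`, and the index of
`U y` in the stabilizer of `y` is at most the number of non-trivial elements of `U y`, because the
quotient acts freely on these by conjugation. -/
structure IsParabolicSystem (p : ℕ) {H X : Type*} [Group H] [MulAction H X]
    (U : X → Subgroup H) : Prop where
  ncard_fixedBy : ∀ h : H, h ≠ 1 → (fixedBy X h).ncard = 1 ∨ (fixedBy X h).ncard = 2
  mem_iff : ∀ y h, h ∈ U y ↔ h = 1 ∨ fixedBy X h = {y}
  dvd_card : ∀ y, U y ≠ ⊥ → p ∣ Nat.card (U y)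
  card_stabilizer_le : ∀ y, U y ≠ ⊥ →
    Nat.card (stabilizer H y) ≤ Nat.card (U y) * (Nat.card (U y) - 1)

namespace IsParabolicSystem

variable {p : ℕ} {H X : Type*} [Group H] [MulAction H X] {U : X → Subgroup H}

theorem le_stabilizer (hU : IsParabolicSystem p U) (y : X) : U y ≤ stabilizer H y := by
  intro h hh
  rcases (hU.mem_iff y h).1 hh with rfl | h1
  · exact one_mem _
  · have : y ∈ fixedBy X h := by rw [h1]; rfl
    exact this

theorem conj_mem (hU : IsParabolicSystem p U) (y : X) (g u : H) (hu : u ∈ U y) :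
    g * u * g⁻¹ ∈ U (g • y) := by
  rw [hU.mem_iff] at hu ⊢
  rcases hu with rfl | h1
  · simp
  · right
    rw [← smul_fixedBy, h1, Set.smul_set_singleton]

theorem card_smul (hU : IsParabolicSystem p U) (y : X) (g : H) :
    Nat.card (U (g • y)) = Nat.card (U y) := by
  symm
  refine Nat.card_congr ((MulAut.conj g).toEquiv.subtypeEquiv fun u => ?_)
  refine ⟨fun hu => hU.conj_mem y g u hu, fun hu => ?_⟩
  have := hU.conj_mem (g • y) g⁻¹ _ hu
  simpa [mul_assoc] using this

theorem finite_setOf_stabilizer_ne_bot [Finite H] (hU : IsParabolicSystem p U) :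
    {x : X | stabilizer H x ≠ ⊥}.Finite := by
  have : {x : X | stabilizer H x ≠ ⊥} ⊆ ⋃ h : {h : H // h ≠ 1}, fixedBy X h.1 := by
    intro x hx
    obtain ⟨⟨h, h1⟩, h2⟩ := Subgroup.ne_bot_iff_exists_ne_one.1 hx
    exact Set.mem_iUnion.2 ⟨⟨h, fun e => h2 (Subtype.ext e)⟩, h1⟩
  refine (Set.finite_iUnion fun h => ?_).subset this
  apply Set.finite_of_ncard_ne_zero
  rcases hU.ncard_fixedBy h.1 h.2 with h | h <;> omega

theorem stabilizer_ne_bot_smul (g : H) {x : X} (hx : stabilizer H x ≠ ⊥) :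
    stabilizer H (g • x) ≠ ⊥ := by
  obtain ⟨⟨a, ha⟩, h1⟩ := Subgroup.ne_bot_iff_exists_ne_one.1 hx
  refine Subgroup.ne_bot_iff_exists_ne_one.2 ⟨⟨g * a * g⁻¹, ?_⟩, ?_⟩
  · have : a • x = x := ha
    simp [mem_stabilizer_iff, mul_smul, this]
  · intro h
    apply h1
    have := congrArg Subtype.val h
    simpa using this

variable (H X) in
/-- The points with non-trivial stabilizer, as an invariant subset. -/
def singularPoints : SubMulAction H X where
  carrier := {x | stabilizer H x ≠ ⊥}
  smul_mem' g _ hx := stabilizer_ne_bot_smul g hx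

/-- Burnside's lemma on the singular points. A non-trivial `h` has either two fixed points, or one
fixed point `y` and `h ∈ U y`; so adding to the fixed points of `h` the points `y` with `h ∈ U y`
always gives `2`. -/
theorem sum_ncard_fixedBy [Finite H] (hU : IsParabolicSystem p U) [Fintype (singularPoints H X)]
    [Fintype (orbitRel.Quotient H (singularPoints H X))] :
    Fintype.card (orbitRel.Quotient H (singularPoints H X)) * Nat.card H + 2
      + ∑ y : singularPoints H X, (Nat.card (U y.1) - 1)
      = Fintype.card (singularPoints H X) + 2 * Nat.card H := by
  classical
  have := Fintype.ofFinite H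
  have hb := sum_card_fixedBy_eq_card_orbits_mul_card_group H (singularPoints H X)
  rw [Nat.card_eq_fintype_card, ← hb]
  have hsub : ∀ y : singularPoints H X, Nat.card (U y.1) - 1 =
      ∑ h ∈ Finset.univ.erase (1 : H), if h ∈ U y.1 then 1 else 0 := by
    intro y
    rw [← Finset.sum_filter, Finset.sum_const, smul_eq_mul, mul_one, Finset.filter_erase,
      Finset.card_erase_of_mem (by simp [one_mem]), Nat.card_eq_fintype_card,
      Fintype.card_subtype]
  simp_rw [hsub]
  rw [Finset.sum_comm, ← Finset.add_sum_erase _ _ (Finset.mem_univ (1 : H))]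
  have h1 : Fintype.card (fixedBy (singularPoints H X) (1 : H)) =
      Fintype.card (singularPoints H X) := by
    apply Fintype.card_congr
    rw [fixedBy_one_eq_univ]
    exact Equiv.Set.univ _
  have h2 : ∀ h ∈ Finset.univ.erase (1 : H),
      Fintype.card (fixedBy (singularPoints H X) h) +
        (∑ y : singularPoints H X, if h ∈ U y.1 then 1 else 0) = 2 := by
    intro h hh
    have hne : h ≠ 1 := Finset.ne_of_mem_erase hh
    have hs : ∀ x ∈ fixedBy X h, x ∈ singularPoints H X := fun x hx =>
      Subgroup.ne_bot_iff_exists_ne_one.2 ⟨⟨h, hx⟩, fun e => hne (congrArg Subtype.val e)⟩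
    have hc : Fintype.card (fixedBy (singularPoints H X) h) = (fixedBy X h).ncard := by
      rw [← Nat.card_eq_fintype_card, ← Nat.card_coe_set_eq]
      refine Nat.card_congr ⟨fun y => ⟨y.1.1, congrArg Subtype.val y.2⟩,
        fun y => ⟨⟨y.1, hs _ y.2⟩, Subtype.ext y.2⟩, fun _ => rfl, fun _ => rfl⟩
    rw [hc]
    rcases hU.ncard_fixedBy h hne with e | e
    · obtain ⟨y, hy⟩ := Set.ncard_eq_one.1 e
      have hym : y ∈ singularPoints H X := hs y (by rw [hy]; rfl)
      rw [e, Finset.sum_eq_single (⟨y, hym⟩ : singularPoints H X)]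
      · rw [if_pos ((hU.mem_iff y h).2 (Or.inr hy))]
      · intro z _ hz
        rw [if_neg]
        intro hm
        rcases (hU.mem_iff _ h).1 hm with h3 | h3
        · exact hne h3
        · rw [hy, Set.singleton_eq_singleton_iff] at h3
          exact hz (Subtype.ext h3.symm)
      · simp
    · rw [e, Finset.sum_eq_zero, add_zero]
      intro z _
      rw [if_neg]
      intro hm
      rcases (hU.mem_iff _ h).1 hm with h3 | h3
      · exact hne h3
      · rw [h3, Set.ncard_singleton] at e
        omega
  have h3 := Finset.sum_congr rfl h2
  rw [Finset.sum_add_distrib, Finset.sum_const, smul_eq_mul,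
    Finset.card_erase_of_mem (Finset.mem_univ _), Finset.card_univ] at h3
  have : 0 < Fintype.card H := Fintype.card_pos
  omega

/-- Representatives of the orbits of points with non-trivial stabilizer, and the relation between
their numbers that Burnside's lemma gives. -/
theorem exists_orbit_representatives [Finite H] (hU : IsParabolicSystem p U) :
    ∃ (r : ℕ) (y : Fin r → X), (∀ i, stabilizer H (y i) ≠ ⊥) ∧
      (∀ x, stabilizer H x ≠ ⊥ → ∃ i, x ∈ orbit H (y i)) ∧
      (∀ i j, y i ∈ orbit H (y j) → i = j) ∧
      r * Nat.card H + 2 + ∑ i, Nat.card (orbit H (y i)) * (Nat.card (U (y i)) - 1)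
        = ∑ i, Nat.card (orbit H (y i)) + 2 * Nat.card H := by
  classical
  have : Finite (singularPoints H X) := hU.finite_setOf_stabilizer_ne_bot
  have := Fintype.ofFinite (singularPoints H X)
  let _ := Fintype.ofFinite (orbitRel.Quotient H (singularPoints H X))
  have hcount := hU.sum_ncard_fixedBy
  let Ω := orbitRel.Quotient H (singularPoints H X)
  let e : Fin (Fintype.card Ω) ≃ Ω := (Fintype.equivFin Ω).symm
  have horb : ∀ a : singularPoints H X, Nat.card (orbit H a) = Nat.card (orbit H a.1) := by
    intro a
    rw [Nat.card_congr (orbitEquivQuotientStabilizer H a),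
      Nat.card_congr (orbitEquivQuotientStabilizer H a.1), SubMulAction.stabilizer_of_subMul]
  have hmem : ∀ a b : singularPoints H X, a.1 ∈ orbit H b.1 ↔ a ∈ orbit H b := by
    intro a b
    constructor
    · rintro ⟨g, hg⟩
      exact ⟨g, Subtype.ext hg⟩
    · rintro ⟨g, hg⟩
      exact ⟨g, congrArg Subtype.val hg⟩
  have hsum : ∀ f : X → ℕ, (∀ (g : H) x, f (g • x) = f x) →
      ∑ y : singularPoints H X, f y.1 = ∑ i, Nat.card (orbit H (e i).out.1) * f (e i).out.1 := by
    intro f hf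
    rw [e.sum_comp (fun ω => Nat.card (orbit H ω.out.1) * f ω.out.1),
      ← (selfEquivSigmaOrbits H (singularPoints H X)).symm.sum_comp, Fintype.sum_sigma]
    refine Finset.sum_congr rfl fun ω _ => ?_
    rw [← horb, Nat.card_eq_fintype_card, ← smul_eq_mul, ← Finset.card_univ, ← Finset.sum_const]
    refine Finset.sum_congr rfl fun x _ => ?_
    obtain ⟨g, hg⟩ := x.2
    have h1 : (selfEquivSigmaOrbits H (singularPoints H X)).symm ⟨ω, x⟩ = x.1 := by
      rfl
    rw [h1, ← hg]
    exact hf _ _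
  refine ⟨Fintype.card Ω, fun i => (e i).out.1, fun i => (e i).out.2, ?_, ?_, ?_⟩
  · intro x hx
    let x' : singularPoints H X := ⟨x, hx⟩
    refine ⟨e.symm (Quotient.mk'' x'), (hmem x' _).2 ?_⟩
    rw [← orbitRel_apply, Equiv.apply_symm_apply]
    exact Setoid.symm' _ (Quotient.exact (Quotient.out_eq _))
  · intro i j hij
    rw [hmem] at hij
    apply e.injective
    have := Quotient.sound (s := orbitRel H (singularPoints H X)) hij
    rwa [Quotient.out_eq, Quotient.out_eq] at this
  · rw [← hsum (fun x => Nat.card (U x) - 1) (fun g x => by rw [hU.card_smul])]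
    have h1 := hsum (fun _ => 1) (fun _ _ => rfl)
    simp only [Finset.sum_const, smul_eq_mul, mul_one, Finset.card_univ] at h1
    rw [← h1]
    exact hcount

end IsParabolicSystem

end

/-! ### The possible orbit structures -/

section

open MulAction

/-- The orders `a ≤ b ≤ c` of the stabilizers in three singular orbits with `k`, `l`, `m` points
satisfy `1/a + 1/b + 1/c = 1 + 2/g`, so they are `(2, 2, g/2)`, `(2, 3, 3)`, `(2, 3, 4)` or
`(2, 3, 5)`. -/
theorem two_three_five_of_le {a b c k l m g : ℕ} (hk : k * a = g) (hl : l * b = g)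
    (hm : m * c = g) (ha : 2 ≤ a) (hab : a ≤ b) (hbc : b ≤ c) (hsum : k + l + m = g + 2) :
    2 * c = g ∨ g = 12 ∨ g = 24 ∨ (g = 60 ∧ a = 2 ∧ b = 3 ∧ c = 5) := by
  have hkl : l ≤ k := by
    by_contra! h
    nlinarith [Nat.mul_lt_mul_of_lt_of_le h hab (by omega)]
  have hlm : m ≤ l := by
    by_contra! h
    nlinarith [Nat.mul_lt_mul_of_lt_of_le h hbc (by omega)]
  have ha2 : a = 2 := by
    by_contra h
    have : k * 3 ≤ k * a := Nat.mul_le_mul_left _ (by omega)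
    omega
  subst ha2
  have hb : b < 4 := by
    by_contra! h
    have : l * 4 ≤ l * b := Nat.mul_le_mul_left _ h
    omega
  obtain rfl | rfl : b = 2 ∨ b = 3 := by omega
  · have : m = 2 := by omega
    subst this
    exact Or.inl hm
  · have hc : c < 6 := by
      by_contra! h
      have : m * 6 ≤ m * c := Nat.mul_le_mul_left _ h
      omega
    obtain rfl | rfl | rfl : c = 3 ∨ c = 4 ∨ c = 5 := by omega
    all_goals omega

/-- The unordered version of `two_three_five_of_le`. In the icosahedral case only the parities that
single out the orbit with stabilizers of order `2` are recorded. -/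
theorem two_three_five {a b c k l m g : ℕ} (hk : k * a = g) (hl : l * b = g) (hm : m * c = g)
    (ha : 2 ≤ a) (hb : 2 ≤ b) (hc : 2 ≤ c) (hsum : k + l + m = g + 2) :
    (2 * a = g ∨ 2 * b = g ∨ 2 * c = g) ∨ g = 12 ∨ g = 24 ∨
      (g = 60 ∧ ((a = 2 ∧ ¬ 2 ∣ b ∧ ¬ 2 ∣ c) ∨ (b = 2 ∧ ¬ 2 ∣ a ∧ ¬ 2 ∣ c) ∨
        (c = 2 ∧ ¬ 2 ∣ a ∧ ¬ 2 ∣ b))) := by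
  rcases le_total a b with h1 | h1 <;> rcases le_total b c with h2 | h2 <;>
    rcases le_total a c with h3 | h3
  · rcases two_three_five_of_le hk hl hm ha h1 h2 (by omega)
      with h | h | h | ⟨h, rfl, rfl, rfl⟩ <;> simp [h]
  · rcases two_three_five_of_le hk hl hm ha h1 h2 (by omega)
      with h | h | h | ⟨h, rfl, rfl, rfl⟩ <;> simp [h]
  · rcases two_three_five_of_le hk hm hl ha h3 h2 (by omega)
      with h | h | h | ⟨h, rfl, rfl, rfl⟩ <;> simp [h]
  · rcases two_three_five_of_le hm hk hl hc h3 h1 (by omega)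
      with h | h | h | ⟨h, rfl, rfl, rfl⟩ <;> simp [h]
  · rcases two_three_five_of_le hl hk hm hb h1 h3 (by omega)
      with h | h | h | ⟨h, rfl, rfl, rfl⟩ <;> simp [h]
  · rcases two_three_five_of_le hl hm hk hb h2 h3 (by omega)
      with h | h | h | ⟨h, rfl, rfl, rfl⟩ <;> simp [h]
  · rcases two_three_five_of_le hm hl hk hc h2 h1 (by omega)
      with h | h | h | ⟨h, rfl, rfl, rfl⟩ <;> simp [h]
  · rcases two_three_five_of_le hm hl hk hc h2 h1 (by omega)
      with h | h | h | ⟨h, rfl, rfl, rfl⟩ <;> simp [h]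

/-- Let `U` be the group of elements fixing only a given point, `q` its order and `q * c` the order
of the stabilizer of the point. Its orbit has `1 + m * q` points, and `a` is the order of the
stabilizers in a second orbit, the size of which Burnside's lemma determines: both sides of the
equation are the order of the group. The last alternative is a group of order `60` in
characteristic `3`. -/
theorem wild_orbit_arithmetic {q c m a : ℕ} (hq : 3 ≤ q) (hc0 : 0 < c) (hc : c ≤ q - 1)
    (hm : 0 < m) (h : (2 + (1 + m * q) * (q - 2)) * a = (1 + m * q) * q * c) :
    (m = 1 ∧ q ≤ 2 * c + 1) ∨ (q = 3 ∧ m = 3 ∧ c = 2 ∧ a = 5) := by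
  obtain ⟨n, rfl⟩ : ∃ n, q = n + 2 := ⟨q - 2, by omega⟩
  simp only [Nat.add_sub_cancel] at h
  have h1 : (1 + m * n) * a = (1 + m * n + 2 * m) * c := by
    apply Nat.eq_of_mul_eq_mul_left (show 0 < n + 2 by omega)
    linarith
  -- `1 + m * n` is prime to `m`, and it divides `2 * m * c`
  have hdvd : 1 + m * n ∣ 2 * c := by
    have h2 : 1 + m * n ∣ m * (2 * c) := by
      refine (Nat.dvd_add_right (Dvd.intro c rfl)).1 ⟨a, ?_⟩
      rw [h1]
      ring
    refine Nat.Coprime.dvd_of_dvd_mul_left ?_ h2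
    simp
  have hle := Nat.le_of_dvd (by omega) hdvd
  rcases Nat.lt_or_ge m 3 with h3 | h3
  · interval_cases m
    · left
      omega
    · obtain ⟨t, ht⟩ := hdvd
      have : t = 1 := by
        have : t < 2 := by
          by_contra! h4
          have := Nat.mul_le_mul_left (1 + 2 * n) h4
          omega
        have : t ≠ 0 := by
          rintro rfl
          omega
        omega
      subst this
      omega
  · have h4 : 3 * n ≤ m * n := Nat.mul_le_mul_right _ h3
    have hn : n = 1 := by omega
    subst hn
    have hm3 : m = 3 := by omega
    subst hm3
    have : c = 2 := by omega
    subst this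
    right
    omega

theorem card_orbit_mul_card_stabilizer {H X : Type*} [Group H] [MulAction H X] (y : X) :
    Nat.card (orbit H y) * Nat.card (stabilizer H y) = Nat.card H := by
  rw [Nat.card_coe_set_eq, ← index_stabilizer, mul_comm, Subgroup.card_mul_index]

theorem card_stabilizer_eq_of_mem_orbit {H X : Type*} [Group H] [MulAction H X] {x y : X}
    (h : x ∈ orbit H y) : Nat.card (stabilizer H x) = Nat.card (stabilizer H y) :=
  Nat.card_congr (stabilizerEquivStabilizerOfOrbitRel h).toEquiv

/-- A group acting freely on an invariant set has order dividing the number of its elements. -/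
theorem Subgroup.card_dvd_ncard_of_free {H X : Type*} [Group H] [MulAction H X] (V : Subgroup H)
    (S : Set X) (hS : ∀ v ∈ V, ∀ x ∈ S, v • x ∈ S)
    (hfree : ∀ v ∈ V, ∀ x ∈ S, v • x = x → v = 1) :
    Nat.card V ∣ S.ncard := by
  let T : SubMulAction V X := ⟨S, fun v x hx => hS v v.2 x hx⟩
  have : ∀ b : T, stabilizer V b = ⊥ := by
    intro b
    rw [eq_bot_iff]
    intro v hv
    exact Subtype.ext (hfree v v.2 b b.2 (congrArg Subtype.val hv))
  have h := Nat.card_congr (selfEquivOrbitsQuotientProd this)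
  rw [Nat.card_prod] at h
  rw [← Nat.card_coe_set_eq]
  exact Dvd.intro_left _ h.symm

namespace IsParabolicSystem

variable {p : ℕ} {H X : Type*} [Group H] [MulAction H X] {U : X → Subgroup H}

theorem eq_one_of_smul_eq (hU : IsParabolicSystem p U) {y x : X} (hxy : x ≠ y) {u : H}
    (hu : u ∈ U y) (h : u • x = x) : u = 1 := by
  rcases (hU.mem_iff y u).1 hu with h1 | h1
  · exact h1
  · have : x ∈ fixedBy X u := h
    rw [h1] at this
    exact absurd this hxy

/-- The group `U y` acts freely on each orbit that does not contain `y`. -/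
theorem card_dvd_card_orbit (hU : IsParabolicSystem p U) {y x : X} (h : y ∉ orbit H x) :
    Nat.card (U y) ∣ Nat.card (orbit H x) := by
  rw [Nat.card_coe_set_eq]
  refine (U y).card_dvd_ncard_of_free _ (fun v _ z hz => mem_orbit_of_mem_orbit v hz)
    fun v hv z hz hvz => hU.eq_one_of_smul_eq ?_ hv hvz
  rintro rfl
  exact h hz

/-- The group `U y` acts freely on the orbit of `y` with `y` removed. -/
theorem exists_card_orbit [Finite H] (hU : IsParabolicSystem p U) (y : X) :
    ∃ m, Nat.card (orbit H y) = 1 + m * Nat.card (U y) := by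
  have h : Nat.card (U y) ∣ (orbit H y \ {y}).ncard := by
    refine (U y).card_dvd_ncard_of_free _ (fun v hv z hz => ⟨mem_orbit_of_mem_orbit v hz.1, ?_⟩)
      fun v hv z hz hvz => hU.eq_one_of_smul_eq hz.2 hv hvz
    intro h1
    apply hz.2
    have h2 : v • y = y := hU.le_stabilizer y hv
    exact (smul_left_cancel v (h2.trans h1.symm)).symm
  obtain ⟨m, hm⟩ := h
  refine ⟨m, ?_⟩
  have hfin : (orbit H y).Finite := Set.finite_range _
  have := Set.ncard_sdiff_singleton_add_one (mem_orbit_self (M := H) y) hfin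
  rw [Nat.card_coe_set_eq, ← this, hm]
  ring

theorem two_le_card_stabilizer [Finite H] {y : X} (hy : stabilizer H y ≠ ⊥) :
    2 ≤ Nat.card (stabilizer H y) := by
  have := (stabilizer H y).one_lt_card_iff_ne_bot.2 hy
  omega

theorem stabilizer_eq_top_of_card_orbit [Finite H] {y : X} (h : Nat.card (orbit H y) = 1) :
    stabilizer H y = ⊤ := by
  apply Subgroup.eq_top_of_card_eq
  rw [← card_orbit_mul_card_stabilizer (H := H) y, h, one_mul]

/-- Groups without elements having a single fixed point. Two singular orbits mean that there is a
global fixed point, and three singular orbits give the dihedral, tetrahedral, octahedral and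
icosahedral cases. In the last case the points with stabilizer of even order have stabilizers of
order `2` and form one orbit. -/
theorem classification_of_tame [Finite H] [Nontrivial H] (hU : IsParabolicSystem p U)
    (htame : ∀ y, U y = ⊥) :
    (∃ y : X, stabilizer H y = ⊤) ∨ (∃ y : X, 2 * Nat.card (stabilizer H y) = Nat.card H) ∨
      Nat.card H = 12 ∨ Nat.card H = 24 ∨
      (Nat.card H = 60 ∧
        (∀ y : X, 2 ∣ Nat.card (stabilizer H y) → Nat.card (stabilizer H y) = 2) ∧
        ∀ y z : X, 2 ∣ Nat.card (stabilizer H y) → 2 ∣ Nat.card (stabilizer H z) →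
          z ∈ orbit H y) := by
  obtain ⟨r, y, hne, hex, hinj, hsum⟩ := hU.exists_orbit_representatives
  have hmul := fun i => card_orbit_mul_card_stabilizer (H := H) (y i)
  have htwo := fun i => two_le_card_stabilizer (hne i)
  have hpos : ∀ i, 0 < Nat.card (orbit H (y i)) := fun i => by
    have := Nat.card_pos (α := H)
    rw [← hmul i] at this
    exact Nat.pos_of_mul_pos_right this
  simp only [htame, Subgroup.card_bot, Nat.sub_self, mul_zero, Finset.sum_const_zero,
    add_zero] at hsum
  have hg : 2 ≤ Nat.card H := Finite.one_lt_card
  have hhalf : ∀ i, 2 * Nat.card (orbit H (y i)) ≤ Nat.card H := fun i => by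
    have := Nat.mul_le_mul_left (Nat.card (orbit H (y i))) (htwo i)
    rw [hmul i] at this
    omega
  -- each singular orbit has at most half as many points as the group has elements
  have hr : r < 4 := by
    have h1 : 2 * ∑ i, Nat.card (orbit H (y i)) ≤ r * Nat.card H := by
      rw [Finset.mul_sum]
      simpa using Finset.sum_le_sum fun i (_ : i ∈ Finset.univ) => hhalf i
    by_contra! h
    have := Nat.mul_le_mul_right (Nat.card H) h
    omega
  interval_cases r
  · simp at hsum
    omega
  · rw [Fin.sum_univ_one] at hsum
    have := hpos 0
    omega
  · rw [Fin.sum_univ_two] at hsum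
    have h0 := hpos 0
    have h1 := hpos 1
    exact Or.inl ⟨y 0, stabilizer_eq_top_of_card_orbit (by omega)⟩
  · rw [Fin.sum_univ_three] at hsum
    have key := two_three_five (hmul 0) (hmul 1) (hmul 2) (htwo 0) (htwo 1) (htwo 2) (by omega)
    have hstab : ∀ x : X, 2 ∣ Nat.card (stabilizer H x) →
        ∃ i, x ∈ orbit H (y i) ∧ 2 ∣ Nat.card (stabilizer H (y i)) := by
      intro x hx
      have : stabilizer H x ≠ ⊥ := by
        intro h
        rw [h, Subgroup.card_bot] at hx
        omega
      obtain ⟨i, hi⟩ := hex x this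
      exact ⟨i, hi, card_stabilizer_eq_of_mem_orbit hi ▸ hx⟩
    have hfin : ∀ i₀, Nat.card (stabilizer H (y i₀)) = 2 →
        (∀ i, i ≠ i₀ → ¬ 2 ∣ Nat.card (stabilizer H (y i))) →
        (∀ y : X, 2 ∣ Nat.card (stabilizer H y) → Nat.card (stabilizer H y) = 2) ∧
        ∀ y z : X, 2 ∣ Nat.card (stabilizer H y) → 2 ∣ Nat.card (stabilizer H z) →
          z ∈ orbit H y := by
      intro i₀ h2 hi₀
      have h3 : ∀ x : X, 2 ∣ Nat.card (stabilizer H x) → x ∈ orbit H (y i₀) := by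
        intro x hx
        obtain ⟨i, hi, hd⟩ := hstab x hx
        by_cases h : i = i₀
        · exact h ▸ hi
        · exact absurd hd (hi₀ i h)
      refine ⟨fun x hx => (card_stabilizer_eq_of_mem_orbit (h3 x hx)).trans h2,
        fun x z hx hz => ?_⟩
      rw [orbit_eq_iff.2 (h3 x hx)]
      exact h3 z hz
    rcases key with (h | h | h) | h | h | ⟨hg, h | h | h⟩
    · exact Or.inr (Or.inl ⟨_, h⟩)
    · exact Or.inr (Or.inl ⟨_, h⟩)
    · exact Or.inr (Or.inl ⟨_, h⟩)
    · exact Or.inr (Or.inr (Or.inl h))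
    · exact Or.inr (Or.inr (Or.inr (Or.inl h)))
    · refine Or.inr (Or.inr (Or.inr (Or.inr ⟨hg, hfin 0 h.1 fun i hi => ?_⟩)))
      fin_cases i
      exacts [absurd rfl hi, h.2.1, h.2.2]
    · refine Or.inr (Or.inr (Or.inr (Or.inr ⟨hg, hfin 1 h.1 fun i hi => ?_⟩)))
      fin_cases i
      exacts [h.2.1, absurd rfl hi, h.2.2]
    · refine Or.inr (Or.inr (Or.inr (Or.inr ⟨hg, hfin 2 h.1 fun i hi => ?_⟩)))
      fin_cases i
      exacts [h.2.1, h.2.2, absurd rfl hi]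

/-- Groups with elements having a single fixed point. The points `y` with non-trivial `U y` form one
orbit and there is at most one other singular orbit. Then there is a global fixed point, or the
group is icosahedral, or the former orbit has the shape of the projective line over a field with
`|U y|` elements. -/
theorem classification_of_wild [Finite H] (hU : IsParabolicSystem p U) (hp : 3 ≤ p)
    {y₀ : X} (hy₀ : U y₀ ≠ ⊥) :
    (∃ y : X, stabilizer H y = ⊤) ∨
      (Nat.card H = 60 ∧
        (∀ y : X, 2 ∣ Nat.card (stabilizer H y) →
          Nat.card (stabilizer H y) = 2 * Nat.card (U y) ∧ Odd (Nat.card (U y))) ∧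
        ∀ y z : X, 2 ∣ Nat.card (stabilizer H y) → 2 ∣ Nat.card (stabilizer H z) →
          z ∈ orbit H y) ∨
      (∃ y : X, U y ≠ ⊥ ∧ Nat.card (orbit H y) = Nat.card (U y) + 1 ∧
        ∃ c, Nat.card (stabilizer H y) = Nat.card (U y) * c ∧ Nat.card (U y) ≤ 2 * c + 1) := by
  obtain ⟨r, y, hne, hex, hinj, hsum⟩ := hU.exists_orbit_representatives
  have hmul := fun i => card_orbit_mul_card_stabilizer (H := H) (y i)
  have htwo := fun i => two_le_card_stabilizer (hne i)
  have hhalf : ∀ i, 2 * Nat.card (orbit H (y i)) ≤ Nat.card H := fun i => by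
    have := Nat.mul_le_mul_left (Nat.card (orbit H (y i))) (htwo i)
    rw [hmul i] at this
    omega
  have hU₀ : stabilizer H y₀ ≠ ⊥ := fun h => hy₀ (by
    rw [eq_bot_iff, ← h]
    exact hU.le_stabilizer y₀)
  obtain ⟨i₀, g, hg⟩ := hex y₀ hU₀
  have hcard₀ : Nat.card (U (y i₀)) = Nat.card (U y₀) := by
    rw [← hg]
    exact (hU.card_smul _ g).symm
  have hi₀ : U (y i₀) ≠ ⊥ := by
    rw [← Subgroup.one_lt_card_iff_ne_bot, hcard₀, Subgroup.one_lt_card_iff_ne_bot]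
    exact hy₀
  obtain ⟨m, hm⟩ := hU.exists_card_orbit (y i₀)
  have hpq := hU.dvd_card _ hi₀
  -- `p` divides the sizes of the orbits not containing a point with non-trivial `U`, while the
  -- orbit of such a point has `1` modulo `p` points, so that two such orbits cannot exist
  have htame : ∀ i, i ≠ i₀ → U (y i) = ⊥ := by
    intro i hi
    by_contra hne
    have h1 := hU.card_dvd_card_orbit (y := y i) (x := y i₀) fun h => hi (hinj _ _ h)
    have h2 := (hU.dvd_card _ hne).trans h1
    rw [hm, Nat.dvd_add_left (hpq.mul_left m)] at h2
    have := Nat.le_of_dvd one_pos h2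
    omega
  set q := Nat.card (U (y i₀)) with hq
  have hq3 : 3 ≤ q := hp.trans (Nat.le_of_dvd Nat.card_pos hpq)
  obtain ⟨c, hc⟩ : q ∣ Nat.card (stabilizer H (y i₀)) :=
    Subgroup.card_dvd_of_le (hU.le_stabilizer _)
  have hc0 : 0 < c := by
    rcases Nat.eq_zero_or_pos c with rfl | h
    · have := htwo i₀
      omega
    · exact h
  have hcq : c ≤ q - 1 := by
    have := hU.card_stabilizer_le _ hi₀
    rw [hc] at this
    exact Nat.le_of_mul_le_mul_left this (by omega)
  rw [← Finset.add_sum_erase _ _ (Finset.mem_univ i₀),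
    ← Finset.add_sum_erase _ (fun i => Nat.card (orbit H (y i))) (Finset.mem_univ i₀)] at hsum
  rw [Finset.sum_eq_zero (s := Finset.univ.erase i₀) (fun i hi => by
    rw [htame i (Finset.ne_of_mem_erase hi)]; simp), add_zero, ← hq] at hsum
  have hsum' : r * Nat.card H + 2 + (1 + m * q) * (q - 2) =
      ∑ i ∈ Finset.univ.erase i₀, Nat.card (orbit H (y i)) + 2 * Nat.card H := by
    have : (1 + m * q) * (q - 1) = (1 + m * q) * (q - 2) + (1 + m * q) := by
      obtain ⟨n, hn⟩ : ∃ n, q = n + 2 := ⟨q - 2, by omega⟩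
      rw [hn]
      simp only [Nat.add_sub_cancel, show n + 2 - 1 = n + 1 by omega]
      ring
    rw [hm, this] at hsum
    omega
  have hg₀ := hmul i₀
  rw [hm, hc, ← mul_assoc] at hg₀
  have hr : r < 3 := by
    have h1 : 2 * ∑ i ∈ Finset.univ.erase i₀, Nat.card (orbit H (y i)) ≤ (r - 1) * Nat.card H := by
      rw [Finset.mul_sum]
      refine (Finset.sum_le_sum fun i (_ : i ∈ _) => hhalf i).trans ?_
      simp
    have h2 : (r - 1) * Nat.card H + Nat.card H = r * Nat.card H := by
      have : r ≠ 0 := by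
        rintro rfl
        exact i₀.elim0
      obtain ⟨n, rfl⟩ := Nat.exists_eq_succ_of_ne_zero this
      simp [Nat.succ_mul]
    by_contra! h
    have := Nat.mul_le_mul_right (Nat.card H) h
    omega
  have hm0 : m = 0 ∨ 0 < m := Nat.eq_zero_or_pos m
  rcases hm0 with rfl | hm0
  · left
    exact ⟨y i₀, stabilizer_eq_top_of_card_orbit (by omega)⟩
  obtain rfl | rfl | rfl : r = 0 ∨ r = 1 ∨ r = 2 := by omega
  · exact i₀.elim0
  · exfalso
    have : (Finset.univ.erase i₀ : Finset (Fin 1)) = ∅ := by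
      ext i
      simp [Subsingleton.elim i i₀]
    rw [this, Finset.sum_empty] at hsum'
    have h1 : Nat.card H = 2 + (1 + m * q) * (q - 2) := by omega
    rw [← hg₀, mul_assoc] at h1
    have h2 : 1 + m * q ∣ 2 := (Nat.dvd_add_left (Dvd.intro _ rfl)).1 ⟨_, h1.symm⟩
    have h3 := Nat.le_of_dvd two_pos h2
    have h4 : 1 * q ≤ m * q := Nat.mul_le_mul_right _ hm0
    omega
  · obtain ⟨j, hj, huniv⟩ : ∃ j, j ≠ i₀ ∧ (Finset.univ.erase i₀ : Finset (Fin 2)) = {j} := by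
      fin_cases i₀
      · exact ⟨1, by decide, by decide⟩
      · exact ⟨0, by decide, by decide⟩
    rw [huniv, Finset.sum_singleton] at hsum'
    have hl : Nat.card (orbit H (y j)) = 2 + (1 + m * q) * (q - 2) := by omega
    have hgj := hmul j
    rw [hl, ← hg₀] at hgj
    rcases wild_orbit_arithmetic hq3 hc0 hcq hm0 hgj with ⟨rfl, h2⟩ | ⟨hq', rfl, rfl, ha⟩
    · exact Or.inr (Or.inr ⟨y i₀, hi₀, by omega, c, hc, h2⟩)
    · right; left
      have h3 : ∀ x : X, 2 ∣ Nat.card (stabilizer H x) → x ∈ orbit H (y i₀) := by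
        intro x hx
        have : stabilizer H x ≠ ⊥ := by
          intro h
          rw [h, Subgroup.card_bot] at hx
          omega
        obtain ⟨i, hi⟩ := hex x this
        by_cases h : i = i₀
        · exact h ▸ hi
        · have : i ∈ (Finset.univ.erase i₀ : Finset (Fin 2)) := by simp [h]
          rw [huniv, Finset.mem_singleton] at this
          rw [card_stabilizer_eq_of_mem_orbit hi, this, ha] at hx
          omega
      refine ⟨by rw [← hg₀, hq']; norm_num, fun x hx => ?_, fun x z hx hz => ?_⟩
      · have h4 : Nat.card (U x) = 3 := by
          obtain ⟨g, hg⟩ := h3 x hx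
          rw [← hq', ← hg]
          exact hU.card_smul _ g
        rw [card_stabilizer_eq_of_mem_orbit (h3 x hx), hc, hq', h4]
        exact ⟨rfl, by decide⟩
      · rw [orbit_eq_iff.2 (h3 x hx)]
        exact h3 z hz

end IsParabolicSystem

end

/-! ### Möbius transformations and the stabilizer of a point -/

section

open MulAction Matrix

section Moebius

variable {F : Type*} [Field F] [DecidableEq F]

theorem OnePoint.exists_smul_eq_infty (y : OnePoint F) :
    ∃ P : GL (Fin 2) F, P • y = OnePoint.infty := by
  induction y using OnePoint.rec with
  | infty => exact ⟨1, one_smul _ _⟩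
  | coe x =>
    refine ⟨GeneralLinearGroup.mkOfDetNeZero !![0, 1; 1, -x] (by simp [det_fin_two]), ?_⟩
    rw [OnePoint.smul_some_eq_ite, if_pos]
    simp [GeneralLinearGroup.mkOfDetNeZero]

theorem OnePoint.exists_affine_of_smul_infty {A : GL (Fin 2) F}
    (hA : A • (OnePoint.infty : OnePoint F) = OnePoint.infty) :
    ∃ α β : F, ∀ x : F, A • (x : OnePoint F) = ((α * x + β : F) : OnePoint F) := by
  rw [OnePoint.smul_infty_eq_self_iff] at hA
  have hd : A 1 1 ≠ 0 := by
    intro h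
    apply A.det_ne_zero
    simp [det_fin_two, hA, h]
  refine ⟨A 0 0 / A 1 1, A 0 1 / A 1 1, fun x => ?_⟩
  rw [OnePoint.smul_some_eq_ite, if_neg (by simpa [hA] using hd)]
  congr 1
  rw [hA, zero_mul, zero_add, add_div]
  ring

theorem OnePoint.exists_smul_eq_self [IsAlgClosed F] (A : GL (Fin 2) F) :
    ∃ y : OnePoint F, A • y = y := by
  by_cases hc : A 1 0 = 0
  · exact ⟨OnePoint.infty, OnePoint.smul_infty_eq_self_iff.2 hc⟩
  · have hdeg : A.fixpointPolynomial.degree ≠ 0 := by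
      have : A.fixpointPolynomial.coeff 2 ≠ 0 := by
        simp [GeneralLinearGroup.fixpointPolynomial, hc]
      intro h
      have := Polynomial.le_degree_of_ne_zero this
      rw [h] at this
      norm_num at this
    obtain ⟨x, hx⟩ := IsAlgClosed.exists_root _ hdeg
    exact ⟨x, GeneralLinearGroup.fixpointPolynomial_aeval_eq_zero_iff.1 (by simpa using hx)⟩

theorem OnePoint.eq_inv_smul_coe_of_ne {P : GL (Fin 2) F} {y z : OnePoint F}
    (hP : P • y = OnePoint.infty) (hz : z ≠ y) : ∃ x : F, z = P⁻¹ • (x : OnePoint F) := by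
  have : P • z ≠ OnePoint.infty := by
    rw [← hP]
    exact fun h => hz (smul_left_cancel P h)
  obtain ⟨x, hx⟩ := OnePoint.ne_infty_iff_exists.1 this
  exact ⟨x, by rw [hx, inv_smul_smul]⟩

theorem OnePoint.inv_smul_coe_ne {P : GL (Fin 2) F} {y : OnePoint F}
    (hP : P • y = OnePoint.infty) (x : F) : P⁻¹ • (x : OnePoint F) ≠ y := by
  intro h
  rw [← h, smul_inv_smul] at hP
  exact OnePoint.coe_ne_infty x hP

theorem OnePoint.inv_smul_coe_injective (P : GL (Fin 2) F) {x x' : F}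
    (h : P⁻¹ • (x : OnePoint F) = P⁻¹ • (x' : OnePoint F)) : x = x' :=
  OnePoint.coe_injective (smul_left_cancel _ h)

variable {H : Type*} [Group H] [MulAction H (OnePoint F)]

variable (F H) in
/-- The group `H` acts on the projective line by Möbius transformations: each element acts like some
invertible matrix. The matrices need not be compatible with the multiplication of `H`. -/
def ActsByMoebius : Prop :=
  ∀ h : H, ∃ A : GL (Fin 2) F, ∀ x : OnePoint F, h • x = A • x

namespace ActsByMoebius

/-- In a chart `P` sending `y` to infinity, the stabilizer of `y` acts by affine maps
`x ↦ α h * x + β h`, and the multiplier `α` is a homomorphism. -/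
theorem exists_affine (hM : ActsByMoebius F H) {P : GL (Fin 2) F} {y : OnePoint F}
    (hP : P • y = OnePoint.infty) :
    ∃ (α : stabilizer H y →* F) (β : stabilizer H y → F), ∀ (h : stabilizer H y) (x : F),
      h.1 • P⁻¹ • (x : OnePoint F) = P⁻¹ • ((α h * x + β h : F) : OnePoint F) := by
  have h1 : ∀ h : stabilizer H y, ∃ α β : F, ∀ x : F,
      h.1 • P⁻¹ • (x : OnePoint F) = P⁻¹ • ((α * x + β : F) : OnePoint F) := by
    intro h
    obtain ⟨A, hA⟩ := hM h.1
    have h2 : (P * A * P⁻¹) • (OnePoint.infty : OnePoint F) = OnePoint.infty := by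
      rw [← hP, mul_smul, inv_smul_smul, mul_smul, ← hA, h.2]
    obtain ⟨α, β, hαβ⟩ := OnePoint.exists_affine_of_smul_infty h2
    refine ⟨α, β, fun x => ?_⟩
    rw [← hαβ, hA, ← mul_smul, ← mul_smul]
    congr 1
    group
  choose α β hαβ using h1
  have huniq : ∀ (h : stabilizer H y) (a b : F),
      (∀ x : F, h.1 • P⁻¹ • (x : OnePoint F) = P⁻¹ • ((a * x + b : F) : OnePoint F)) → α h = a := by
    intro h a b hab
    have h0 := OnePoint.inv_smul_coe_injective P ((hαβ h 0).symm.trans (hab 0))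
    have h1 := OnePoint.inv_smul_coe_injective P ((hαβ h 1).symm.trans (hab 1))
    linear_combination h1 - h0
  refine ⟨⟨⟨α, huniq 1 1 0 fun x => by simp⟩, fun g h => ?_⟩, β, hαβ⟩
  refine huniq _ _ (α g * β h + β g) fun x => ?_
  rw [Subgroup.coe_mul, mul_smul, hαβ, hαβ]
  ring_nf

/-- Conjugation by `g` multiplies the length of a translation by the multiplier of `g`. -/
theorem smul_conj_translation {P : GL (Fin 2) F} {y : OnePoint F}
    {α : stabilizer H y →* F} {β : stabilizer H y → F}
    (hαβ : ∀ (h : stabilizer H y) (x : F),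
      h.1 • P⁻¹ • (x : OnePoint F) = P⁻¹ • ((α h * x + β h : F) : OnePoint F))
    {u : stabilizer H y} (hu : α u = 1) (g : stabilizer H y) (x : F) :
    (g * u * g⁻¹).1 • P⁻¹ • (x : OnePoint F) = P⁻¹ • ((x + α g * β u : F) : OnePoint F) := by
  simp only [Subgroup.coe_mul, mul_smul, hαβ, hu]
  have h1 : x = α g * (α g⁻¹ * x + β g⁻¹) + β g := by
    have h2 := hαβ g (α g⁻¹ * x + β g⁻¹)
    rw [← hαβ, ← mul_smul, ← Subgroup.coe_mul, mul_inv_cancel, Subgroup.coe_one, one_smul] at h2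
    exact OnePoint.inv_smul_coe_injective P h2
  congr 2
  linear_combination -h1

variable [FaithfulSMul H (OnePoint F)]

theorem eq_one_of_affine {P : GL (Fin 2) F} {y : OnePoint F}
    (hP : P • y = OnePoint.infty) {h : H} (hy : h • y = y)
    (hx : ∀ x : F, h • P⁻¹ • (x : OnePoint F) = P⁻¹ • (x : OnePoint F)) : h = 1 := by
  refine eq_of_smul_eq_smul fun z : OnePoint F => ?_
  rw [one_smul]
  by_cases hz : z = y
  · rw [hz, hy]
  · obtain ⟨x, rfl⟩ := OnePoint.eq_inv_smul_coe_of_ne hP hz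
    exact hx x

/-- In an affine chart sending `y` to infinity, the elements with multiplier `1` are the identity
and the elements fixing `y` only. -/
theorem multiplier_eq_one_iff {P : GL (Fin 2) F} {y : OnePoint F}
    (hP : P • y = OnePoint.infty) {α : stabilizer H y →* F} {β : stabilizer H y → F}
    (hαβ : ∀ (h : stabilizer H y) (x : F),
      h.1 • P⁻¹ • (x : OnePoint F) = P⁻¹ • ((α h * x + β h : F) : OnePoint F))
    (h : stabilizer H y) : α h = 1 ↔ h = 1 ∨ fixedBy (OnePoint F) h.1 = {y} := by
  constructor
  · intro h1
    by_cases hβ : β h = 0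
    · left
      refine Subtype.ext (eq_one_of_affine hP h.2 fun x => ?_)
      rw [hαβ, h1, hβ, one_mul, add_zero]
    · right
      refine Set.Subset.antisymm (fun z hz => ?_) (by rintro _ rfl; exact h.2)
      by_contra hzy
      obtain ⟨x, rfl⟩ := OnePoint.eq_inv_smul_coe_of_ne hP hzy
      have := OnePoint.inv_smul_coe_injective P ((hαβ h x).symm.trans hz)
      rw [h1] at this
      apply hβ
      linear_combination this
  · rintro (rfl | h1)
    · exact map_one α
    · by_contra hα
      have hα' : 1 - α h ≠ 0 := sub_ne_zero.2 (Ne.symm hα)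
      have : P⁻¹ • ((β h / (1 - α h) : F) : OnePoint F) ∈ fixedBy (OnePoint F) h.1 := by
        rw [mem_fixedBy, hαβ]
        congr 2
        field_simp
        ring
      rw [h1] at this
      exact OnePoint.inv_smul_coe_ne hP _ this

/-- A Möbius transformation over an algebraically closed field has a fixed point; with this point at
infinity it is a translation or has exactly one further fixed point. -/
theorem ncard_fixedBy [IsAlgClosed F] (hM : ActsByMoebius F H) (h : H) (h1 : h ≠ 1) :
    (fixedBy (OnePoint F) h).ncard = 1 ∨ (fixedBy (OnePoint F) h).ncard = 2 := by
  obtain ⟨A, hA⟩ := hM h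
  obtain ⟨y, hy⟩ := OnePoint.exists_smul_eq_self A
  rw [← hA] at hy
  obtain ⟨P, hP⟩ := OnePoint.exists_smul_eq_infty y
  obtain ⟨α, β, hαβ⟩ := hM.exists_affine hP
  let h' : stabilizer H y := ⟨h, hy⟩
  by_cases hα : α h' = 1
  · left
    rcases (multiplier_eq_one_iff hP hαβ h').1 hα with h2 | h2
    · exact absurd (congrArg Subtype.val h2) h1
    · exact (congrArg Set.ncard h2).trans (Set.ncard_singleton y)
  · right
    have hα' : 1 - α h' ≠ 0 := sub_ne_zero.2 (Ne.symm hα)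
    have : fixedBy (OnePoint F) h = {y, P⁻¹ • ((β h' / (1 - α h') : F) : OnePoint F)} := by
      ext z
      rw [mem_fixedBy, Set.mem_insert_iff, Set.mem_singleton_iff]
      constructor
      · intro hz
        rw [or_iff_not_imp_left]
        intro hzy
        obtain ⟨x, rfl⟩ := OnePoint.eq_inv_smul_coe_of_ne hP hzy
        have := OnePoint.inv_smul_coe_injective P ((hαβ h' x).symm.trans hz)
        congr 2
        rw [eq_div_iff hα']
        linear_combination -this
      · rintro (rfl | rfl)
        · exact hy
        · refine (hαβ h' _).trans ?_
          congr 2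
          field_simp
          ring
    rw [this, Set.ncard_pair (OnePoint.inv_smul_coe_ne hP _).symm]

/-- The structure of the stabilizer of a point `y`: the elements with multiplier `1` form a subgroup
`V` of exponent `p`. The quotient by `V` embeds into the multiplicative group of the field, so that
it is abelian and has at most one involution, the one with multiplier `-1`. It acts freely by
conjugation on the non-trivial elements of `V`. -/
theorem exists_parabolic_subgroup {p : ℕ} [Fact p.Prime] [CharP F p] [Finite H]
    (hM : ActsByMoebius F H) (y : OnePoint F) :
    ∃ V : Subgroup H, (∀ h, h ∈ V ↔ h = 1 ∨ fixedBy (OnePoint F) h = {y}) ∧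
      (∀ v ∈ V, v ^ p = 1) ∧
      (V ≠ ⊥ → Nat.card (stabilizer H y) ≤ Nat.card V * (Nat.card V - 1)) ∧
      (∀ a ∈ stabilizer H y, ∀ b ∈ stabilizer H y, a * b * (b * a)⁻¹ ∈ V) ∧
      (∀ a ∈ stabilizer H y, ∀ b ∈ stabilizer H y, a ∉ V → b ∉ V → a * a = 1 → b * b = 1 →
        a * b ∈ V) := by
  obtain ⟨P, hP⟩ := OnePoint.exists_smul_eq_infty y
  obtain ⟨α, β, hαβ⟩ := hM.exists_affine hP
  have hker := multiplier_eq_one_iff hP hαβ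
  have hmem : ∀ h : stabilizer H y, h.1 ∈ α.ker.map (stabilizer H y).subtype ↔ α h = 1 := by
    intro h
    rw [← MonoidHom.mem_ker]
    exact Subgroup.mem_map_iff_mem Subtype.val_injective
  refine ⟨α.ker.map (stabilizer H y).subtype, fun h => ?_, ?_, ?_, ?_, ?_⟩
  · constructor
    · rintro ⟨h, hh, rfl⟩
      exact ((hker h).1 hh).imp (congrArg Subtype.val) id
    · intro hh
      have hs : h ∈ stabilizer H y := by
        rcases hh with rfl | hh
        · exact one_mem _
        · have : y ∈ fixedBy (OnePoint F) h := by rw [hh]; rfl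
          exact this
      exact (hmem ⟨h, hs⟩).2 ((hker ⟨h, hs⟩).2 (hh.imp Subtype.ext id))
  · rintro _ ⟨h, hh, rfl⟩
    have hh : α h = 1 := hh
    have hpow : ∀ (n : ℕ) (x : F),
        h.1 ^ n • P⁻¹ • (x : OnePoint F) = P⁻¹ • ((x + n * β h : F) : OnePoint F) := by
      intro n
      induction n with
      | zero => simp
      | succ n ih =>
        intro x
        rw [pow_succ, mul_smul, hαβ, ih, hh]
        congr 2
        push_cast
        ring
    refine eq_one_of_affine hP (pow_mem h.2 p : h.1 ^ p ∈ stabilizer H y) fun x => ?_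
    rw [Subgroup.coe_subtype, hpow, CharP.cast_eq_zero, zero_mul, add_zero]
  · intro hV
    obtain ⟨⟨_, u, hu, rfl⟩, hu1⟩ := Subgroup.ne_bot_iff_exists_ne_one.1 hV
    have hu : α u = 1 := hu
    have hu1 : u ≠ 1 := fun h => hu1 (Subtype.ext (by simp [h]))
    have hβu : β u ≠ 0 := by
      intro hβ
      refine hu1 (Subtype.ext (eq_one_of_affine hP u.2 fun x => ?_))
      rw [hαβ, hu, hβ, one_mul, add_zero]
    set V := α.ker.map (stabilizer H y).subtype with hVdef
    have hcard : Nat.card V = Nat.card α.ker :=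
      (Nat.card_congr (α.ker.equivMapOfInjective _ Subtype.val_injective).toEquiv).symm
    -- conjugates of a fixed translation `u` by elements with distinct multipliers are distinct
    have hindex : α.ker.index ≤ Nat.card {v : V // v ≠ 1} := by
      let f : stabilizer H y → {v : V // v ≠ 1} := fun h =>
        ⟨⟨(h * u * h⁻¹).1, (hmem _).2 (by
            rw [map_mul, map_mul, hu, mul_one, ← map_mul, mul_inv_cancel, map_one])⟩, by
          intro h1
          have h2 : h * u * h⁻¹ = 1 := Subtype.ext (congrArg (fun v : V => (v : H)) h1)
          exact hu1 (by simpa using h2)⟩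
      have hf : ∀ g h, f g = f h → α g = α h := by
        intro g h hgh
        have h1 : g * u * g⁻¹ = h * u * h⁻¹ :=
          Subtype.ext (congrArg (fun v : {v : V // v ≠ 1} => v.1.1) hgh)
        have key := smul_conj_translation hαβ hu
        have h2 := key g 0
        rw [h1, key h 0] at h2
        have h3 := OnePoint.inv_smul_coe_injective P h2
        have h4 : α h * β u = α g * β u := by linear_combination h3
        exact (mul_right_cancel₀ hβu h4).symm
      let f' : stabilizer H y ⧸ α.ker → {v : V // v ≠ 1} := fun q => f q.out
      refine Nat.card_le_card_of_injective f' fun q q' hqq => ?_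
      have h1 := hf _ _ hqq
      rw [← QuotientGroup.out_eq' q, ← QuotientGroup.out_eq' q']
      rw [QuotientGroup.eq, MonoidHom.mem_ker, map_mul, ← h1, ← map_mul, inv_mul_cancel, map_one]
    have hsub : Nat.card {v : V // v ≠ 1} = Nat.card V - 1 := by
      have := Fintype.ofFinite V
      classical
      rw [Nat.card_eq_fintype_card, Nat.card_eq_fintype_card, Fintype.card_subtype_compl]
      simp
    rw [← α.ker.card_mul_index, ← hcard, ← hsub]
    exact Nat.mul_le_mul_left _ hindex
  · intro a ha b hb
    refine (hmem (⟨a, ha⟩ * ⟨b, hb⟩ * (⟨b, hb⟩ * ⟨a, ha⟩)⁻¹)).2 ?_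
    rw [map_mul, map_mul, mul_comm (α ⟨a, ha⟩), ← map_mul, ← map_mul, mul_inv_cancel, map_one]
  · intro a ha b hb haV hbV haa hbb
    have h1 : ∀ c (hc : c ∈ stabilizer H y), c ∉ α.ker.map (stabilizer H y).subtype → c * c = 1 →
        α ⟨c, hc⟩ = -1 := by
      intro c hc hcV hcc
      have h2 : α ⟨c, hc⟩ * α ⟨c, hc⟩ = 1 := by
        rw [← map_mul, ← map_one α]
        congr 1
        exact Subtype.ext hcc
      rcases mul_self_eq_one_iff.1 h2 with h3 | h3
      · exact absurd ((hmem ⟨c, hc⟩).2 h3) hcV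
      · exact h3
    refine (hmem (⟨a, ha⟩ * ⟨b, hb⟩)).2 ?_
    rw [map_mul, h1 a ha haV haa, h1 b hb hbV hbb]
    ring

end ActsByMoebius

end Moebius

end

/-! ### Groups generated by string triples: the symmetric and the alternating group -/

section

section SmallGroups

variable {H : Type*} [Group H]

theorem semiconjBy_inv_of_mul_self {s t : H} (hs : s * s = 1) (ht : t * t = 1) :
    SemiconjBy s (s * t) (s * t)⁻¹ := by
  have hs' := inv_eq_of_mul_eq_one_left hs
  have ht' := inv_eq_of_mul_eq_one_left ht
  rw [SemiconjBy, mul_inv_rev, hs', ht', ← mul_assoc, hs, one_mul, mul_assoc, hs, mul_one]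

theorem exists_conj_eq_of_odd_orderOf_mul {z w : H} (hz : z * z = 1) (hw : w * w = 1)
    (h : Odd (orderOf (z * w))) : ∃ g, g * z * g⁻¹ = w := by
  obtain ⟨k, hk⟩ := h
  have h1 : z * ((z * w) ^ k)⁻¹ = (z * w) ^ k * z := by
    have := (semiconjBy_inv_of_mul_self hz hw).inv_right.pow_right k
    rw [inv_inv] at this
    rw [← inv_pow]
    exact this
  refine ⟨(z * w) ^ k, ?_⟩
  have h2 : (z * w) ^ k * (z * w) ^ k * (z * w) = 1 := by
    rw [← pow_add, ← pow_succ, ← two_mul, ← hk, pow_orderOf_eq_one]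
  rw [mul_assoc, h1, ← mul_assoc, eq_inv_of_mul_eq_one_left h2, mul_inv_rev, mul_assoc,
    inv_mul_cancel, mul_one, inv_eq_of_mul_eq_one_left hw]

/-- Two involutions generate a dihedral group, which consists of rotations and reflections. -/
theorem exists_zpow_of_mem_closure_pair {s t x : H} (hs : s * s = 1) (ht : t * t = 1)
    (hx : x ∈ Subgroup.closure {s, t}) :
    ∃ i : ℤ, x = (s * t) ^ i ∨ x = (s * t) ^ i * s := by
  have hcomm : ∀ j : ℤ, s * (s * t) ^ j = (s * t) ^ (-j) * s := by
    intro j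
    have := (semiconjBy_inv_of_mul_self hs ht).zpow_right j
    rw [inv_zpow'] at this
    exact this
  have hs' := inv_eq_of_mul_eq_one_left hs
  induction hx using Subgroup.closure_induction with
  | mem y hy =>
    rcases hy with rfl | rfl
    · exact ⟨0, Or.inr (by simp)⟩
    · refine ⟨-1, Or.inr ?_⟩
      rw [← hcomm, zpow_one, ← mul_assoc, hs, one_mul]
  | one => exact ⟨0, Or.inl (by simp)⟩
  | mul y z _ _ hy hz =>
    obtain ⟨i, rfl | rfl⟩ := hy <;> obtain ⟨j, rfl | rfl⟩ := hz
    · exact ⟨i + j, Or.inl (zpow_add _ _ _).symm⟩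
    · exact ⟨i + j, Or.inr (by rw [zpow_add, mul_assoc])⟩
    · exact ⟨i + -j, Or.inr (by rw [zpow_add, mul_assoc, hcomm, mul_assoc])⟩
    · refine ⟨i + -j, Or.inl ?_⟩
      rw [zpow_add, mul_assoc, ← mul_assoc s, hcomm, mul_assoc, hs, mul_one]
  | inv y _ hy =>
    obtain ⟨i, rfl | rfl⟩ := hy
    · exact ⟨-i, Or.inl (zpow_neg _ _).symm⟩
    · exact ⟨i, Or.inr (by rw [mul_inv_rev, hs', ← zpow_neg, hcomm, neg_neg])⟩

theorem zpow_eq_of_orderOf_eq_three {r : H} (hr : orderOf r = 3) (i : ℤ) :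
    r ^ i = 1 ∨ r ^ i = r ∨ r ^ i = r⁻¹ := by
  have h3 : r ^ 3 = 1 := hr ▸ pow_orderOf_eq_one r
  rw [← zpow_mod_orderOf, hr]
  obtain h | h | h : i % ((3 : ℕ) : ℤ) = 0 ∨ i % ((3 : ℕ) : ℤ) = 1 ∨ i % ((3 : ℕ) : ℤ) = 2 := by
    omega
  · rw [h]
    simp
  · rw [h]
    simp
  · right; right
    rw [h]
    refine eq_inv_of_mul_eq_one_left ?_
    rw [← zpow_add_one]
    exact_mod_cast h3

/-- The elements `s`, `t`, `u` are involutions, `s` and `u` are distinct and commute, and no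
involution commutes with both `s` and `t`. This holds for the first three of the generators in a
string representation of `PSL₂(q)` of rank `4` whose facet group is a proper subgroup. -/
structure IsStringTriple (s t u : H) : Prop where
  mul_self_left : s * s = 1
  mul_self_mid : t * t = 1
  mul_self_right : u * u = 1
  left_ne_one : s ≠ 1
  mid_ne_one : t ≠ 1
  right_ne_one : u ≠ 1
  left_ne_right : s ≠ u
  comm : s * u = u * s
  eq_one_of_commute : ∀ z, z * z = 1 → Commute z s → Commute z t → z = 1

namespace IsStringTriple

variable {s t u : H}

theorem mul_mul_self (h : IsStringTriple s t u) : (s * u) * (s * u) = 1 := by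
  rw [mul_assoc, ← mul_assoc u, ← h.comm, mul_assoc s u u, h.mul_self_right, mul_one,
    h.mul_self_left]

theorem mul_ne_one (h : IsStringTriple s t u) : s * u ≠ 1 := by
  intro h1
  apply h.left_ne_right
  rw [eq_inv_of_mul_eq_one_left h1, inv_eq_of_mul_eq_one_left h.mul_self_right]

theorem commute_mid {z : H} (h : IsStringTriple s t u) (hs : Commute z s)
    (hr : Commute z (s * t)) : Commute z t := by
  have : t = s * (s * t) := by rw [← mul_assoc, h.mul_self_left, one_mul]
  rw [this]
  exact hs.mul_right hr

theorem not_commute_right (h : IsStringTriple s t u) : ¬ Commute u (s * t) := by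
  intro h1
  exact h.right_ne_one (h.eq_one_of_commute u h.mul_self_right h.comm.symm
    (h.commute_mid h.comm.symm h1))

theorem not_commute_mul (h : IsStringTriple s t u) : ¬ Commute (s * u) (s * t) := by
  intro h1
  have hs : Commute (s * u) s := (Commute.refl s).mul_left h.comm.symm
  exact h.mul_ne_one (h.eq_one_of_commute _ h.mul_mul_self hs (h.commute_mid hs h1))

/-- A non-trivial normal subgroup of the dihedral group `⟨s, t⟩` of order `6` contains the rotation
`s * t`. If this rotation generated a normal subgroup of the whole group, `u` would centralize or
invert `s * t`, and one of the involutions `u` and `s * u` would commute with both `s` and `t`. -/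
theorem normalCore_closure_pair (h : IsStringTriple s t u) (hr : orderOf (s * t) = 3) :
    (Subgroup.closure {s, t}).normalCore = ⊥ := by
  set D := Subgroup.closure {s, t} with hD
  set N := D.normalCore with hN
  have h3 : (s * t) ^ 3 = 1 := hr ▸ pow_orderOf_eq_one _
  have hr1 : s * t ≠ 1 := by
    intro h1
    rw [h1, orderOf_one] at hr
    omega
  have hr2 : s * t * (s * t) ≠ 1 := by
    intro h1
    apply hr1
    rw [← h3, pow_succ, pow_two, h1, one_mul]
  have hsemi := semiconjBy_inv_of_mul_self h.mul_self_left h.mul_self_mid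
  rw [Subgroup.eq_bot_iff_forall]
  intro x hx
  by_contra hx1
  have hrN : s * t ∈ N := by
    obtain ⟨i, rfl | rfl⟩ := exists_zpow_of_mem_closure_pair h.mul_self_left h.mul_self_mid
      (D.normalCore_le hx)
    · rcases zpow_eq_of_orderOf_eq_three hr i with h1 | h1 | h1
      · exact absurd h1 hx1
      · rwa [h1] at hx
      · rw [h1] at hx
        exact (inv_mem_iff).1 hx
    · -- the commutator of a rotation with a reflection is the square of the rotation
      have h1 : (s * t) * ((s * t) ^ i * s) * (s * t)⁻¹ * ((s * t) ^ i * s)⁻¹ ∈ N :=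
        mul_mem (Subgroup.normalCore_normal D |>.conj_mem _ hx _) (inv_mem hx)
      have h2 : (s * t) * ((s * t) ^ i * s) * (s * t)⁻¹ * ((s * t) ^ i * s)⁻¹ =
          (s * t) * (s * t) := by
        have h4 : s * (s * t)⁻¹ * s⁻¹ = s * t := by
          rw [hsemi.inv_right.eq, inv_inv, mul_inv_cancel_right]
        calc _ = (s * t) * (s * t) ^ i * (s * (s * t)⁻¹ * s⁻¹) * ((s * t) ^ i)⁻¹ := by group
          _ = _ := by
            rw [h4]
            generalize s * t = r
            group
            exact zpow_two r
      rw [h2] at h1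
      have h4 : s * t = ((s * t) * (s * t)) * ((s * t) * (s * t)) := by
        rw [← pow_two, ← pow_two, ← pow_mul]
        rw [show 2 * 2 = 3 + 1 by norm_num, pow_succ, h3, one_mul]
      rw [h4]
      exact mul_mem h1 h1
  have hconj : u * (s * t) * u⁻¹ ∈ D :=
    D.normalCore_le ((Subgroup.normalCore_normal D).conj_mem _ hrN u)
  obtain ⟨i, hi | hi⟩ := exists_zpow_of_mem_closure_pair h.mul_self_left h.mul_self_mid hconj
  · rcases zpow_eq_of_orderOf_eq_three hr i with h1 | h1 | h1
    · rw [h1] at hi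
      exact hr1 (by simpa using hi)
    · rw [h1, mul_inv_eq_iff_eq_mul] at hi
      exact h.not_commute_right hi
    · rw [h1, mul_inv_eq_iff_eq_mul] at hi
      exact h.not_commute_mul ((SemiconjBy.inv_right hsemi).mul_left
        (y := (s * t)⁻¹) hi |>.trans (by rw [inv_inv]))
  · have h1 : (u * (s * t) * u⁻¹) * (u * (s * t) * u⁻¹) = 1 := by
      rw [hi]
      have h2 := (hsemi.zpow_right i).eq
      rw [inv_zpow] at h2
      calc _ = (s * t) ^ i * (s * (s * t) ^ i) * s := by group
        _ = s * s := by rw [h2]; group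
        _ = 1 := h.mul_self_left
    apply hr2
    have h2 : u * ((s * t) * (s * t)) * u⁻¹ = 1 := by
      rw [← h1]
      group
    simpa using h2

theorem card_closure_pair [Finite H] (h : IsStringTriple s t u) (hr : orderOf (s * t) = 3) :
    Nat.card (Subgroup.closure {s, t}) = 6 := by
  have hs : s ∈ Subgroup.closure {s, t} := Subgroup.subset_closure (by simp)
  have ht : t ∈ Subgroup.closure {s, t} := Subgroup.subset_closure (by simp)
  have h2 : 2 ∣ Nat.card (Subgroup.closure {s, t}) := by
    have : orderOf s = 2 := orderOf_eq_prime (by rw [pow_two, h.mul_self_left]) h.left_ne_one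
    rw [← this]
    exact Subgroup.orderOf_dvd_natCard _ hs
  have h3 : 3 ∣ Nat.card (Subgroup.closure {s, t}) := by
    rw [← hr]
    exact Subgroup.orderOf_dvd_natCard _ (mul_mem hs ht)
  have hle : Nat.card (Subgroup.closure {s, t}) ≤ 6 := by
    classical
    let A : Finset H := {1, s * t, (s * t)⁻¹, s, s * t * s, (s * t)⁻¹ * s}
    have hA : ((Subgroup.closure {s, t} : Subgroup H) : Set H) ⊆ A := by
      intro x hx
      simp only [A, Finset.coe_insert, Finset.coe_singleton, Set.mem_insert_iff,
        Set.mem_singleton_iff]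
      obtain ⟨i, rfl | rfl⟩ := exists_zpow_of_mem_closure_pair h.mul_self_left h.mul_self_mid hx
      · rcases zpow_eq_of_orderOf_eq_three hr i with h1 | h1 | h1 <;> simp [h1]
      · rcases zpow_eq_of_orderOf_eq_three hr i with h1 | h1 | h1 <;> simp [h1]
    have := Set.ncard_le_ncard hA A.finite_toSet
    rw [Set.ncard_coe_finset] at this
    exact this.trans Finset.card_le_six
  have hpos : 0 < Nat.card (Subgroup.closure {s, t}) := Nat.card_pos
  omega

theorem card_ne_twelve [Finite H] (h : IsStringTriple s t u) (hr : orderOf (s * t) = 3) :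
    Nat.card H ≠ 12 := by
  intro hH
  have h1 := (Subgroup.closure {s, t}).card_mul_index
  rw [h.card_closure_pair hr, hH] at h1
  have := Subgroup.normal_of_index_eq_two (H := Subgroup.closure {s, t}) (by omega)
  have h2 := h.normalCore_closure_pair hr
  rw [Subgroup.normalCore_eq_self] at h2
  have h3 := h.card_closure_pair hr
  rw [h2, Subgroup.card_bot] at h3
  omega

/-- The action on the four cosets of the dihedral group `⟨s, t⟩` of order `6` is faithful. -/
theorem nonempty_mulEquiv_perm [Finite H] (h : IsStringTriple s t u) (hr : orderOf (s * t) = 3)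
    (hH : Nat.card H = 24) : Nonempty (H ≃* Equiv.Perm (Fin 4)) := by
  have h1 := (Subgroup.closure {s, t}).card_mul_index
  rw [h.card_closure_pair hr, hH] at h1
  have h4 : Nat.card (H ⧸ Subgroup.closure {s, t}) = 4 := by
    rw [← Subgroup.index]
    omega
  have h2 := h.normalCore_closure_pair hr
  rw [Subgroup.normalCore_eq_ker, MonoidHom.ker_eq_bot_iff] at h2
  have h3 := (Nat.bijective_iff_injective_and_card _).2 ⟨h2, by
    rw [Nat.card_perm, h4, hH]
    rfl⟩
  exact ⟨(MulEquiv.ofBijective _ h3).trans (Finite.equivFinOfCardEq h4).permCongrHom⟩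

end IsStringTriple

/-- A group of order `60` generated by a string triple in which all involutions are conjugate, with
centralizers of order at most `4`, is isomorphic to `A₅`: it acts faithfully on the five conjugates
of the Klein four-group `⟨s, u⟩`. -/
theorem nonempty_mulEquiv_alternatingGroup [Finite H] {s t u : H} (h : IsStringTriple s t u)
    (hgen : Subgroup.closure {s, t, u} = ⊤) (hH : Nat.card H = 60)
    (hcent : ∀ z : H, z ≠ 1 → z * z = 1 → Nat.card (Subgroup.centralizer {z}) ≤ 4)
    (hconj : ∀ z w : H, z ≠ 1 → z * z = 1 → w ≠ 1 → w * w = 1 → ∃ g, g * z * g⁻¹ = w) :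
    Nonempty (H ≃* alternatingGroup (Fin 5)) := by
  classical
  let A : Finset H := {1, s, u, s * u}
  have hA4 : A.card = 4 := by
    have h1 : (1 : H) ∉ ({s, u, s * u} : Finset H) := by
      simp only [Finset.mem_insert, Finset.mem_singleton, not_or]
      exact ⟨h.left_ne_one.symm, h.right_ne_one.symm, h.mul_ne_one.symm⟩
    have h2 : s ∉ ({u, s * u} : Finset H) := by
      simp [h.left_ne_right, h.right_ne_one]
    have h3 : u ∉ ({s * u} : Finset H) := by
      simp [h.left_ne_one]
    rw [Finset.card_insert_of_notMem h1, Finset.card_insert_of_notMem h2,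
      Finset.card_insert_of_notMem h3, Finset.card_singleton]
  -- the centralizer of an involution commuting with `s` and `u` contains `⟨s, u⟩`, so equals it
  have hcA : ∀ z : H, z ≠ 1 → z * z = 1 → Commute z s → Commute z u →
      ((Subgroup.centralizer {z} : Subgroup H) : Set H) = A := by
    intro z hz hzz hs hu
    symm
    refine Set.eq_of_subset_of_ncard_le ?_ ?_ (Set.toFinite _)
    · intro x hx
      simp only [A, Finset.coe_insert, Finset.coe_singleton, Set.mem_insert_iff,
        Set.mem_singleton_iff] at hx
      rw [SetLike.mem_coe, Subgroup.mem_centralizer_singleton_iff]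
      rcases hx with rfl | rfl | rfl | rfl
      · simp
      · exact hs.symm
      · exact hu.symm
      · exact (hs.mul_right hu).symm
    · rw [Set.ncard_coe_finset, hA4, ← Nat.card_coe_set_eq]
      exact hcent z hz hzz
  have hsA := hcA s h.left_ne_one h.mul_self_left (Commute.refl s) h.comm
  have huA := hcA u h.right_ne_one h.mul_self_right h.comm.symm (Commute.refl u)
  have hVu : Subgroup.centralizer {u} = Subgroup.centralizer {s} :=
    SetLike.coe_injective (huA.trans hsA.symm)
  set V := Subgroup.centralizer {s} with hV
  have hV4 : Nat.card V = 4 := by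
    rw [← SetLike.coe_sort_coe, hsA]
    simpa using hA4
  have hVmem : ∀ x ∈ V, x = 1 ∨ x = s ∨ x = u ∨ x = s * u := by
    intro x hx
    rw [← SetLike.mem_coe, hsA] at hx
    simpa [A] using hx
  have hVself : ∀ x ∈ V, x * x = 1 := by
    intro x hx
    rcases hVmem x hx with rfl | rfl | rfl | rfl
    · simp
    · exact h.mul_self_left
    · exact h.mul_self_right
    · exact h.mul_mul_self
  have hsV : s ∈ V := by rw [hV, Subgroup.mem_centralizer_singleton_iff]
  set N := Subgroup.normalizer (V : Set H) with hN
  have hVN : V ≤ N := Subgroup.le_normalizer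
  have hN12 : Nat.card N = 12 := by
    have h1 : Nat.card V ∣ Nat.card N := Subgroup.card_dvd_of_le hVN
    have h2 : Nat.card N ∣ 60 := hH ▸ N.card_subgroup_dvd_card
    -- an element conjugating `s` to `u` normalizes the common centralizer `V` of `s` and `u`,
    -- but is not in `V`
    have h3 : Nat.card N ≠ 4 := by
      intro h4
      have hNV : V = N := Subgroup.eq_of_le_of_card_ge hVN (by rw [h4, hV4])
      obtain ⟨g, hg⟩ := hconj s u h.left_ne_one h.mul_self_left h.right_ne_one h.mul_self_right
      have hgN : g ∈ N := by
        rw [hN, Subgroup.mem_normalizer_iff]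
        intro x
        nth_rw 2 [← hVu]
        rw [hV, Subgroup.mem_centralizer_singleton_iff, Subgroup.mem_centralizer_singleton_iff,
          ← hg]
        constructor
        · intro hx
          calc g * x * g⁻¹ * (g * s * g⁻¹) = g * (x * s) * g⁻¹ := by group
            _ = _ := by rw [hx]; group
        · intro hx
          have : g * (x * s) * g⁻¹ = g * (s * x) * g⁻¹ := by
            calc g * (x * s) * g⁻¹ = g * x * g⁻¹ * (g * s * g⁻¹) := by group
              _ = _ := by rw [hx]; group
          simpa using this
      rw [← hNV, hV, Subgroup.mem_centralizer_singleton_iff] at hgN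
      apply h.left_ne_right
      rw [← hg, hgN, mul_inv_cancel_right]
    -- `N` permutes the three involutions of `V`, and the stabilizer of `s` is `V`
    have h4 : Nat.card N ≤ 12 := by
      have := Fintype.ofFinite H
      let S : Finset H := Finset.univ.filter (· ∈ N)
      have hS : S.card = Nat.card N := by
        rw [Nat.card_eq_fintype_card, Fintype.card_subtype]
      have himg : S.image (fun n => n * s * n⁻¹) ⊆ A.erase 1 := by
        intro x hx
        obtain ⟨n, hn, rfl⟩ := Finset.mem_image.1 hx
        have hn : n ∈ N := by simpa [S] using hn
        rw [Finset.mem_erase]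
        refine ⟨fun h1 => h.left_ne_one (by simpa using h1), ?_⟩
        rw [← Finset.mem_coe, ← hsA]
        exact (Subgroup.mem_normalizer_iff.1 hn s).1 hsV
      have hfib : ∀ a ∈ S.image (fun n => n * s * n⁻¹),
          (S.filter (fun n => n * s * n⁻¹ = a)).card ≤ 4 := by
        intro a ha
        obtain ⟨m, hm, rfl⟩ := Finset.mem_image.1 ha
        rw [← hA4]
        refine Finset.card_le_card_of_injOn (fun n => m⁻¹ * n) (fun n hn => ?_)
          (fun _ _ _ _ e => mul_left_cancel e)
        have hn : n * s * n⁻¹ = m * s * m⁻¹ := by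
          simp only [Finset.coe_filter, Set.mem_ofPred_eq] at hn
          exact hn.2
        rw [← hsA, SetLike.mem_coe, hV, Subgroup.mem_centralizer_singleton_iff]
        calc m⁻¹ * n * s = m⁻¹ * (n * s * n⁻¹) * n := by group
          _ = s * (m⁻¹ * n) := by rw [hn]; group
      have h5 := Finset.card_le_mul_card_image S 4 hfib
      have h6 := Finset.card_le_card himg
      rw [Finset.card_erase_of_mem (by simp [A]), hA4] at h6
      omega
    rw [hV4] at h1
    obtain ⟨k, hk⟩ := h1
    rw [hk] at h2 h3 h4 ⊢
    have : k ≤ 3 := by omega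
    interval_cases k <;> omega
  have hcore : N.normalCore = ⊥ := by
    have hnorm := Subgroup.normalCore_normal N
    -- a normal subgroup with an involution contains all of them, so is the whole group
    have hno : ∀ z ∈ N.normalCore, z * z = 1 → z = 1 := by
      intro z hz hzz
      by_contra hz1
      have hall : ∀ w, w ≠ 1 → w * w = 1 → w ∈ N.normalCore := by
        intro w hw hww
        obtain ⟨g, rfl⟩ := hconj z w hz1 hzz hw hww
        exact hnorm.conj_mem z hz g
      have htop : N.normalCore = ⊤ := by
        rw [eq_top_iff, ← hgen, Subgroup.closure_le]
        rintro x (rfl | rfl | rfl)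
        · exact hall _ h.left_ne_one h.mul_self_left
        · exact hall _ h.mid_ne_one h.mul_self_mid
        · exact hall _ h.right_ne_one h.mul_self_right
      have hNtop : N = ⊤ := by
        rw [eq_top_iff, ← htop]
        exact N.normalCore_le
      rw [hNtop, Subgroup.card_top] at hN12
      omega
    -- an element `c` of the core has its commutator with `s` in the core and in `V`; this
    -- commutator squares to `1`, so it is trivial, and `c` is in the centralizer `V` of `s`
    rw [Subgroup.eq_bot_iff_forall]
    intro c hc
    have hcN := N.normalCore_le hc
    have h1 : c * s * c⁻¹ * s⁻¹ ∈ V :=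
      mul_mem ((Subgroup.mem_normalizer_iff.1 hcN s).1 hsV) (inv_mem hsV)
    have h2 : c * s * c⁻¹ * s⁻¹ ∈ N.normalCore := by
      have : c * (s * c⁻¹ * s⁻¹) ∈ N.normalCore := mul_mem hc (hnorm.conj_mem _ (inv_mem hc) s)
      convert this using 1
      group
    have h3 := hno _ h2 (hVself _ h1)
    have h4 : c ∈ V := by
      rw [hV, Subgroup.mem_centralizer_singleton_iff, ← mul_inv_eq_iff_eq_mul]
      rwa [mul_inv_eq_one] at h3
    exact hno c hc (hVself c h4)
  have h5 : Nat.card (H ⧸ N) = 5 := by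
    have := N.card_mul_index
    rw [hN12, hH, Subgroup.index] at this
    omega
  rw [Subgroup.normalCore_eq_ker, MonoidHom.ker_eq_bot_iff] at hcore
  let e := (Finite.equivFinOfCardEq h5).permCongrHom
  let φ : H →* Equiv.Perm (Fin 5) := e.toMonoidHom.comp (MulAction.toPermHom H (H ⧸ N))
  have hφ : Function.Injective φ := e.injective.comp hcore
  have hcard : Nat.card φ.range = 60 := by
    rw [← hH]
    exact (Nat.card_congr (MonoidHom.ofInjective hφ).toEquiv).symm
  have hindex : φ.range.index = 2 := by
    have := φ.range.card_mul_index
    rw [hcard, Nat.card_perm, Nat.card_fin] at this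
    simp only [Nat.factorial] at this
    omega
  have hrange : alternatingGroup (Fin 5) = φ.range := by
    refine Subgroup.eq_of_le_of_card_ge
      (Equiv.Perm.alternatingGroup_le_of_index_le_two hindex.le) ?_
    rw [hcard, nat_card_alternatingGroup, Nat.card_fin]
    decide
  exact ⟨(MonoidHom.ofInjective hφ).trans (MulEquiv.subgroupCongr hrange.symm)⟩

end SmallGroups

end

/-! ### Involutions in the projective special linear group of degree two -/

section

open Matrix
open scoped MatrixGroups

section TwoByTwo

variable {K : Type*} [Field K]

/-- The centralizer of a non-scalar `2 × 2` matrix is commutative. -/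
theorem Matrix.commute_of_commute_of_not_scalar {A B C : Matrix (Fin 2) (Fin 2) K}
    (hA : A 0 1 ≠ 0 ∨ A 1 0 ≠ 0 ∨ A 0 0 ≠ A 1 1) (hB : A * B = B * A) (hC : A * C = C * A) :
    B * C = C * B := by
  have hB' := fun i j => congrFun (congrFun hB i) j
  have hC' := fun i j => congrFun (congrFun hC i) j
  simp only [Matrix.mul_apply, Fin.sum_univ_two, Fin.forall_fin_two] at hB' hC'
  obtain ⟨⟨b1, b2⟩, b3, b4⟩ := hB'
  obtain ⟨⟨c1, c2⟩, c3, c4⟩ := hC'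
  ext i j
  simp only [Matrix.mul_apply, Fin.sum_univ_two]
  rcases hA with h | h | h
  · fin_cases i <;> fin_cases j <;> simp only [Fin.mk_zero, Fin.mk_one] <;>
      apply mul_left_cancel₀ h <;> grind
  · fin_cases i <;> fin_cases j <;> simp only [Fin.mk_zero, Fin.mk_one] <;>
      apply mul_left_cancel₀ h <;> grind
  · have h := sub_ne_zero.2 h
    fin_cases i <;> fin_cases j <;> simp only [Fin.mk_zero, Fin.mk_one] <;>
      apply mul_left_cancel₀ h <;> grind

/-- Commuting traceless matrices are proportional. -/
theorem Matrix.exists_eq_smul_of_commute (h2 : (2 : K) ≠ 0) {A B : Matrix (Fin 2) (Fin 2) K}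
    (hA : A.trace = 0) (hB : B.trace = 0) (hA0 : A ≠ 0) (hAB : A * B = B * A) :
    ∃ r : K, B = r • A := by
  rw [trace_fin_two] at hA hB
  have hAB' := fun i j => congrFun (congrFun hAB i) j
  simp only [Matrix.mul_apply, Fin.sum_univ_two, Fin.forall_fin_two] at hAB'
  obtain ⟨⟨b1, b2⟩, b3, b4⟩ := hAB'
  have hA1 : A 1 1 = -A 0 0 := by linear_combination hA
  have hB1 : B 1 1 = -B 0 0 := by linear_combination hB
  rw [hA1, hB1] at b2 b3
  have e1 : A 0 0 * B 0 1 = A 0 1 * B 0 0 := mul_left_cancel₀ h2 (by linear_combination b2)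
  have e2 : A 0 0 * B 1 0 = A 1 0 * B 0 0 := mul_left_cancel₀ h2 (by linear_combination -b3)
  have e3 : A 0 1 * B 1 0 = A 1 0 * B 0 1 := by linear_combination b1
  have hne : A 0 0 ≠ 0 ∨ A 0 1 ≠ 0 ∨ A 1 0 ≠ 0 := by
    by_contra! h
    apply hA0
    ext i j
    fin_cases i <;> fin_cases j <;> simp [h.1, h.2.1, h.2.2, hA1]
  rcases hne with h | h | h
  · refine ⟨B 0 0 / A 0 0, ?_⟩
    ext i j
    fin_cases i <;> fin_cases j <;> simp [hA1, hB1] <;> field_simp <;> grind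
  · refine ⟨B 0 1 / A 0 1, ?_⟩
    ext i j
    fin_cases i <;> fin_cases j <;> simp [hA1, hB1] <;> field_simp <;> grind
  · refine ⟨B 1 0 / A 1 0, ?_⟩
    ext i j
    fin_cases i <;> fin_cases j <;> simp [hA1, hB1] <;> field_simp <;> grind

/-- A traceless matrix anticommuting with `A` and `B` is a multiple of their commutator. -/
theorem Matrix.exists_eq_smul_commutator (h2 : (2 : K) ≠ 0) {A B Z : Matrix (Fin 2) (Fin 2) K}
    (hZ : Z.trace = 0) (hAB : A * B ≠ B * A) (hA : Z * A = -(A * Z)) (hB : Z * B = -(B * Z)) :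
    ∃ r : K, Z = r • (A * B - B * A) := by
  refine exists_eq_smul_of_commute h2 ?_ hZ (sub_ne_zero.2 hAB) ?_
  · rw [trace_sub, trace_mul_comm, sub_self]
  · have h1 : Z * (A * B) = A * B * Z := by
      rw [← mul_assoc, hA, neg_mul, mul_assoc, hB, mul_neg, neg_neg, mul_assoc]
    have h2 : Z * (B * A) = B * A * Z := by
      rw [← mul_assoc, hB, neg_mul, mul_assoc, hA, mul_neg, neg_neg, mul_assoc]
    rw [sub_mul, mul_sub, h1, h2]

end TwoByTwo

namespace Matrix.ProjectiveSpecialLinearGroup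

variable {K : Type*} [Field K]

theorem mk_eq_mk_iff (A B : SL(2, K)) :
    (QuotientGroup.mk A : PSL(2, K)) = QuotientGroup.mk B ↔
      (A : Matrix (Fin 2) (Fin 2) K) = B ∨ (A : Matrix (Fin 2) (Fin 2) K) = -B := by
  rw [eq_comm, QuotientGroup.eq, SpecialLinearGroup.mem_center_iff]
  constructor
  · rintro ⟨r, hr, h⟩
    have h1 : (A : Matrix (Fin 2) (Fin 2) K) = B * scalar (Fin 2) r := by
      rw [h, ← SpecialLinearGroup.coe_mul, mul_inv_cancel_left]
    rcases mul_self_eq_one_iff.1 ((pow_two r).symm.trans hr) with rfl | rfl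
    · left
      simpa using h1
    · right
      rw [h1, map_neg, map_one, mul_neg, mul_one]
  · rintro (h | h)
    · refine ⟨1, one_pow _, ?_⟩
      have : A = B := Subtype.ext h
      simp [this]
    · refine ⟨-1, by simp, ?_⟩
      have h1 : (B⁻¹ * A : SL(2, K)).1 = (B⁻¹ : SL(2, K)).1 * A.1 := rfl
      have h2 : (B⁻¹ : SL(2, K)).1 * B.1 = 1 := by
        rw [← SpecialLinearGroup.coe_mul, inv_mul_cancel, SpecialLinearGroup.coe_one]
      rw [SpecialLinearGroup.coe_mul, h, mul_neg, h2]
      ext i j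
      fin_cases i <;> fin_cases j <;> simp

/-- Involutions of `PSL₂(K)` lift to matrices of trace zero. -/
theorem trace_eq_zero_of_mul_self {A : SL(2, K)} (h1 : (QuotientGroup.mk A : PSL(2, K)) ≠ 1)
    (h : (QuotientGroup.mk A : PSL(2, K)) * QuotientGroup.mk A = 1) :
    (A : Matrix (Fin 2) (Fin 2) K).trace = 0 := by
  have h2 : (QuotientGroup.mk A : PSL(2, K)) = QuotientGroup.mk A⁻¹ := by
    rw [QuotientGroup.mk_inv]
    exact eq_inv_of_mul_eq_one_left h
  have h1' : ¬ ((A : Matrix (Fin 2) (Fin 2) K) = 1 ∨ (A : Matrix (Fin 2) (Fin 2) K) = -1) := by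
    rw [← SpecialLinearGroup.coe_one, ← mk_eq_mk_iff]
    exact h1
  rw [mk_eq_mk_iff, SpecialLinearGroup.coe_inv, adjugate_fin_two] at h2
  have hdet := A.det_coe
  rw [det_fin_two] at hdet
  rw [trace_fin_two]
  rcases h2 with h2 | h2
  · have h3 := fun i j => congrFun (congrFun h2 i) j
    simp [Fin.forall_fin_two] at h3
    obtain ⟨⟨a, b⟩, c, d⟩ := h3
    by_contra htr
    by_cases hchar : (2 : K) = 0
    · apply htr
      linear_combination a + A.1 1 1 * hchar
    · have hb : A.1 0 1 = 0 := by
        have : 2 * A.1 0 1 = 0 := by linear_combination b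
        exact (mul_eq_zero.1 this).resolve_left hchar
      have hc : A.1 1 0 = 0 := by
        have : 2 * A.1 1 0 = 0 := by linear_combination c
        exact (mul_eq_zero.1 this).resolve_left hchar
      have hsq : A.1 0 0 * A.1 0 0 = 1 := by
        rw [hb, ← a] at hdet
        linear_combination hdet
      apply h1'
      rcases mul_self_eq_one_iff.1 hsq with h4 | h4
      · left
        ext i j
        fin_cases i <;> fin_cases j <;> simp [h4, hb, hc, ← a]
      · right
        ext i j
        fin_cases i <;> fin_cases j <;> simp [h4, hb, hc, ← a]
  · have h3 := congrFun (congrFun h2 0) 0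
    simp at h3
    linear_combination h3

/-- The centre of `PSL₂(K)` is trivial. Two elementary matrices suffice as tests; they commute with
a lift of a central element up to sign only, and the sign `-1` has to be excluded. -/
theorem eq_one_of_forall_commute {A : SL(2, K)}
    (h : ∀ B : SL(2, K), (QuotientGroup.mk A : PSL(2, K)) * QuotientGroup.mk B =
      QuotientGroup.mk B * QuotientGroup.mk A) : (QuotientGroup.mk A : PSL(2, K)) = 1 := by
  have hdet := A.det_coe
  rw [det_fin_two] at hdet
  obtain ⟨T, hT⟩ : ∃ T : SL(2, K), T.1 = !![1, 1; 0, 1] := ⟨⟨_, by simp [det_fin_two]⟩, rfl⟩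
  obtain ⟨S, hS⟩ : ∃ S : SL(2, K), S.1 = !![1, 0; 1, 1] := ⟨⟨_, by simp [det_fin_two]⟩, rfl⟩
  have hU := h T
  have hL := h S
  rw [← QuotientGroup.mk_mul, ← QuotientGroup.mk_mul, mk_eq_mk_iff, SpecialLinearGroup.coe_mul,
    SpecialLinearGroup.coe_mul] at hU hL
  rw [hT] at hU
  rw [hS] at hL
  have hUa : (A.1 1 0 = 0 ∧ A.1 0 0 = A.1 1 1) := by
    rcases hU with hU | hU
    all_goals
      have h3 := fun i j => congrFun (congrFun hU i) j
      simp [Fin.forall_fin_two, Matrix.mul_apply, Matrix.vecMul, dotProduct, Fin.sum_univ_two] at h3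
    · obtain ⟨⟨a, b⟩, d⟩ := h3
      exact ⟨by simpa using a, by linear_combination b⟩
    · obtain ⟨⟨a, b⟩, c, d⟩ := h3
      by_cases hchar : (2 : K) = 0
      · have hc : A.1 1 0 = 0 := by linear_combination a - A.1 0 0 * hchar
        exact ⟨hc, by linear_combination b - (A.1 0 1 + A.1 1 1) * hchar⟩
      · have hc : A.1 1 0 = 0 := by
          have : 2 * A.1 1 0 = 0 := by linear_combination c
          exact (mul_eq_zero.1 this).resolve_left hchar
        have ha : A.1 0 0 = 0 := by
          have : 2 * A.1 0 0 = 0 := by linear_combination a - hc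
          exact (mul_eq_zero.1 this).resolve_left hchar
        rw [hc, ha] at hdet
        simp at hdet
  have hLb : A.1 0 1 = 0 := by
    rcases hL with hL | hL
    all_goals
      have h3 := congrFun (congrFun hL 0) 0
      have h4 := congrFun (congrFun hL 0) 1
      simp [Matrix.mul_apply, Matrix.vecMul, dotProduct, Fin.sum_univ_two] at h3 h4
    · exact h3
    · by_cases hchar : (2 : K) = 0
      · linear_combination h3 - A.1 0 0 * hchar
      · have : 2 * A.1 0 1 = 0 := by linear_combination h4
        exact (mul_eq_zero.1 this).resolve_left hchar
  have hsq : A.1 0 0 * A.1 0 0 = 1 := by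
    rw [hLb, ← hUa.2] at hdet
    linear_combination hdet
  refine (mk_eq_mk_iff A 1).2 ?_
  rcases mul_self_eq_one_iff.1 hsq with h4 | h4
  · left
    ext i j
    fin_cases i <;> fin_cases j <;> simp [h4, hLb, hUa.1, ← hUa.2]
  · right
    ext i j
    fin_cases i <;> fin_cases j <;> simp [h4, hLb, hUa.1, ← hUa.2]

theorem eq_of_eq_smul {A B : SL(2, K)} {r : K}
    (h : (A : Matrix (Fin 2) (Fin 2) K) = r • (B : Matrix (Fin 2) (Fin 2) K)) :
    (QuotientGroup.mk A : PSL(2, K)) = QuotientGroup.mk B := by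
  have h1 := congrArg det h
  rw [det_smul, SpecialLinearGroup.det_coe, SpecialLinearGroup.det_coe, mul_one,
    Fintype.card_fin] at h1
  rw [mk_eq_mk_iff, h]
  rcases mul_self_eq_one_iff.1 ((pow_two r).symm.trans h1.symm) with rfl | rfl
  · left
    simp
  · right
    simp

/-- Distinct commuting involutions of `PSL₂(K)` lift to anticommuting matrices in odd
characteristic. -/
theorem mul_eq_neg_mul_of_commute (h2 : (2 : K) ≠ 0) {A B : SL(2, K)}
    (hA : (A : Matrix (Fin 2) (Fin 2) K).trace = 0) (hB : (B : Matrix (Fin 2) (Fin 2) K).trace = 0)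
    (hne : (QuotientGroup.mk A : PSL(2, K)) ≠ QuotientGroup.mk B)
    (h : (QuotientGroup.mk A : PSL(2, K)) * QuotientGroup.mk B =
      QuotientGroup.mk B * QuotientGroup.mk A) :
    (A : Matrix (Fin 2) (Fin 2) K) * B = -(B * A) := by
  rw [← QuotientGroup.mk_mul, ← QuotientGroup.mk_mul, mk_eq_mk_iff, SpecialLinearGroup.coe_mul,
    SpecialLinearGroup.coe_mul] at h
  refine h.resolve_left fun hAB => hne ?_
  have hB0 : (B : Matrix (Fin 2) (Fin 2) K) ≠ 0 := by
    intro h0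
    have := B.det_coe
    rw [h0] at this
    simp at this
  obtain ⟨r, hr⟩ := exists_eq_smul_of_commute h2 hB hA hB0 hAB.symm
  exact eq_of_eq_smul hr

theorem mul_ne_mul_of_not_commute {A B : SL(2, K)}
    (h : ¬ (QuotientGroup.mk A : PSL(2, K)) * QuotientGroup.mk B =
      QuotientGroup.mk B * QuotientGroup.mk A) :
    (A : Matrix (Fin 2) (Fin 2) K) * B ≠ B * A := by
  intro h1
  apply h
  rw [← QuotientGroup.mk_mul, ← QuotientGroup.mk_mul, mk_eq_mk_iff]
  exact Or.inl h1

/-- In odd characteristic at most one involution of `PSL₂(K)` commutes with two given non-commuting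
involutions: it lifts to a multiple of the commutator of their lifts. -/
theorem eq_of_commute_of_commute (h2 : (2 : K) ≠ 0) {g h z w : PSL(2, K)} (hg : g * g = 1)
    (hh : h * h = 1) (hz : z * z = 1) (hw : w * w = 1) (hz1 : z ≠ 1) (hw1 : w ≠ 1)
    (hgh : ¬ Commute g h) (hzg : Commute z g) (hzh : Commute z h) (hwg : Commute w g)
    (hwh : Commute w h) : z = w := by
  have hg1 : g ≠ 1 := by
    rintro rfl
    exact hgh (Commute.one_left _)
  have hh1 : h ≠ 1 := by
    rintro rfl
    exact hgh (Commute.one_right _)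
  have hne : ∀ x : PSL(2, K), Commute x g → Commute x h → x ≠ g ∧ x ≠ h := by
    intro x hxg hxh
    constructor
    · rintro rfl
      exact hgh hxh
    · rintro rfl
      exact hgh hxg.symm
  obtain ⟨hzg', hzh'⟩ := hne z hzg hzh
  obtain ⟨hwg', hwh'⟩ := hne w hwg hwh
  obtain ⟨A, rfl⟩ := QuotientGroup.mk_surjective g
  obtain ⟨B, rfl⟩ := QuotientGroup.mk_surjective h
  obtain ⟨Z, rfl⟩ := QuotientGroup.mk_surjective z
  obtain ⟨W, rfl⟩ := QuotientGroup.mk_surjective w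
  have tA := trace_eq_zero_of_mul_self hg1 hg
  have tB := trace_eq_zero_of_mul_self hh1 hh
  have tZ := trace_eq_zero_of_mul_self hz1 hz
  have tW := trace_eq_zero_of_mul_self hw1 hw
  have hAB := mul_ne_mul_of_not_commute hgh
  obtain ⟨r, hr⟩ := exists_eq_smul_commutator h2 tZ hAB
    (mul_eq_neg_mul_of_commute h2 tZ tA hzg' hzg) (mul_eq_neg_mul_of_commute h2 tZ tB hzh' hzh)
  obtain ⟨s, hs⟩ := exists_eq_smul_commutator h2 tW hAB
    (mul_eq_neg_mul_of_commute h2 tW tA hwg' hwg) (mul_eq_neg_mul_of_commute h2 tW tB hwh' hwh)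
  have hs0 : s ≠ 0 := by
    rintro rfl
    have := W.det_coe
    rw [hs] at this
    simp at this
  refine eq_of_eq_smul (r := r / s) ?_
  rw [hs, smul_smul, div_mul_cancel₀ _ hs0]
  exact hr

/-- In characteristic two, commuting is transitive through non-trivial elements. -/
theorem commute_of_commute_of_char_two (h2 : (2 : K) = 0) {g h z : PSL(2, K)} (hz1 : z ≠ 1)
    (hzg : Commute z g) (hzh : Commute z h) : Commute g h := by
  obtain ⟨A, rfl⟩ := QuotientGroup.mk_surjective g
  obtain ⟨B, rfl⟩ := QuotientGroup.mk_surjective h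
  obtain ⟨Z, rfl⟩ := QuotientGroup.mk_surjective z
  have hneg : ∀ M : Matrix (Fin 2) (Fin 2) K, -M = M := by
    intro M
    ext i j
    rw [Matrix.neg_apply]
    linear_combination -M i j * h2
  have hcomm : ∀ A B : SL(2, K), Commute (QuotientGroup.mk A : PSL(2, K)) (QuotientGroup.mk B) ↔
      (A : Matrix (Fin 2) (Fin 2) K) * B = B * A := by
    intro A B
    rw [Commute, SemiconjBy, ← QuotientGroup.mk_mul, ← QuotientGroup.mk_mul, mk_eq_mk_iff, hneg,
      or_self]
    rfl
  rw [hcomm] at hzg hzh ⊢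
  refine commute_of_commute_of_not_scalar ?_ hzg hzh
  by_contra! h
  have hdet := Z.det_coe
  rw [det_fin_two] at hdet
  have hsq : Z.1 0 0 * Z.1 0 0 = 1 := by
    rw [h.1, ← h.2.2] at hdet
    linear_combination hdet
  refine hz1 ((mk_eq_mk_iff Z 1).2 ?_)
  rcases mul_self_eq_one_iff.1 hsq with h4 | h4
  · left
    ext i j
    fin_cases i <;> fin_cases j <;> simp [h4, h.1, h.2.1, ← h.2.2]
  · right
    ext i j
    fin_cases i <;> fin_cases j <;> simp [h4, h.1, h.2.1, ← h.2.2]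

/-- The order of `PSL₂(q)` is `(q + 1) q (q - 1) / 2` for odd `q`; only the upper bound is
established. -/
theorem two_mul_card_le [Finite K] (h2 : (2 : K) ≠ 0) :
    2 * Nat.card PSL(2, K) ≤ (Nat.card K + 1) * Nat.card K * (Nat.card K - 1) := by
  classical
  have := Fintype.ofFinite K
  have hGL : Nat.card (GL (Fin 2) K) = (Nat.card K ^ 2 - 1) * (Nat.card K ^ 2 - Nat.card K) := by
    rw [Matrix.card_GL_field, Fin.prod_univ_two, Nat.card_eq_fintype_card]
    simp
  have hdet := (GeneralLinearGroup.det (n := Fin 2) (R := K)).ker.card_mul_index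
  rw [Subgroup.index_ker, MonoidHom.range_eq_top.2 GeneralLinearGroup.det_surjective,
    Subgroup.card_top, hGL, Nat.card_units] at hdet
  have hSL : Nat.card SL(2, K) ≤ Nat.card (GeneralLinearGroup.det (n := Fin 2) (R := K)).ker := by
    refine Nat.card_le_card_of_injective
      (fun A => ⟨SpecialLinearGroup.toGL A, by simp [MonoidHom.mem_ker]⟩) fun A B h => ?_
    exact SpecialLinearGroup.toGL_injective (congrArg Subtype.val h)
  have hcenter := (Subgroup.center SL(2, K)).card_mul_index
  have hc2 : 2 ≤ Nat.card (Subgroup.center SL(2, K)) := by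
    have h1 : (-1 : SL(2, K)) ∈ Subgroup.center SL(2, K) := by
      rw [Subgroup.mem_center_iff]
      intro g
      simp
    have : Subgroup.center SL(2, K) ≠ ⊥ := by
      intro h
      rw [h, Subgroup.mem_bot] at h1
      have h3 : (-1 : K) = 1 := by
        simpa using congrArg (fun A : SL(2, K) => A.1 0 0) h1
      apply h2
      linear_combination -h3
    have := (Subgroup.one_lt_card_iff_ne_bot _).2 this
    omega
  have hq : 2 ≤ Nat.card K := Finite.one_lt_card
  rw [Subgroup.index] at hcenter
  obtain ⟨n, hn⟩ : ∃ n, Nat.card K = n + 1 := ⟨Nat.card K - 1, by omega⟩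
  rw [hn] at hdet ⊢
  have e1 : (n + 1) ^ 2 - 1 = (n + 2) * n := by
    rw [Nat.sub_eq_iff_eq_add (Nat.one_le_pow _ _ (by omega))]
    ring
  have e2 : (n + 1) ^ 2 - (n + 1) = (n + 1) * n := by
    rw [Nat.sub_eq_iff_eq_add (Nat.le_self_pow (by omega) _)]
    ring
  rw [e1, e2, Nat.add_sub_cancel] at hdet
  have e3 : Nat.card (GeneralLinearGroup.det (n := Fin 2) (R := K)).ker =
      (n + 2) * (n + 1) * n := by
    apply Nat.eq_of_mul_eq_mul_right (show 0 < n by omega)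
    rw [hdet]
    ring
  rw [e3] at hSL
  rw [Nat.add_sub_cancel]
  calc 2 * Nat.card PSL(2, K) ≤ _ := Nat.mul_le_mul_right _ hc2
    _ = _ := hcenter
    _ ≤ _ := hSL

end Matrix.ProjectiveSpecialLinearGroup

end

/-! ### Projective lines over subfields and rational matrices -/

section

open MulAction Matrix

section Subline

variable {F : Type*} [Field F] [DecidableEq F]

theorem OnePoint.exists_smul_eq_infty_zero_one {y y₀ y₁ : OnePoint F} (h0 : y₀ ≠ y) (h1 : y₁ ≠ y)
    (h01 : y₀ ≠ y₁) : ∃ P : GL (Fin 2) F, P • y = OnePoint.infty ∧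
      P • y₀ = ((0 : F) : OnePoint F) ∧ P • y₁ = ((1 : F) : OnePoint F) := by
  obtain ⟨P, hP⟩ := OnePoint.exists_smul_eq_infty y
  obtain ⟨a, rfl⟩ := OnePoint.eq_inv_smul_coe_of_ne hP h0
  obtain ⟨b, rfl⟩ := OnePoint.eq_inv_smul_coe_of_ne hP h1
  have hab : b - a ≠ 0 := by
    intro h
    apply h01
    rw [sub_eq_zero.1 h]
  refine ⟨GeneralLinearGroup.mkOfDetNeZero !![1, -a; 0, b - a] (by simpa [det_fin_two]) * P,
    ?_, ?_, ?_⟩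
  · rw [mul_smul, hP, OnePoint.smul_infty_eq_self_iff]
    simp [GeneralLinearGroup.mkOfDetNeZero]
  · rw [mul_smul, smul_inv_smul, OnePoint.smul_some_eq_ite]
    simp [GeneralLinearGroup.mkOfDetNeZero, hab]
  · rw [mul_smul, smul_inv_smul, OnePoint.smul_some_eq_ite]
    simp [GeneralLinearGroup.mkOfDetNeZero, hab, ← sub_eq_add_neg]

/-- The points of the projective line over a subfield `k`. -/
def Subfield.projectivePoints (k : Subfield F) : Set (OnePoint F) :=
  {x | x = OnePoint.infty ∨ ∃ a ∈ k, x = ((a : F) : OnePoint F)}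

/-- The multipliers of a finite subgroup `B` of the additive group of a field: the elements `a` with
`a * B ⊆ B`. Finiteness makes `b ↦ a * b` bijective on `B` for `a ≠ 0`, hence the inverses. -/
def AddSubgroup.multiplierSubfield (B : AddSubgroup F) [Finite B] : Subfield F where
  carrier := {a | ∀ b ∈ B, a * b ∈ B}
  mul_mem' {a c} ha hc b hb := by
    rw [mul_assoc]
    exact ha _ (hc b hb)
  one_mem' b hb := by rwa [one_mul]
  add_mem' {a c} ha hc b hb := by
    rw [add_mul]
    exact add_mem (ha b hb) (hc b hb)
  zero_mem' b hb := by
    rw [zero_mul]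
    exact zero_mem B
  neg_mem' {a} ha b hb := by
    rw [neg_mul]
    exact neg_mem (ha b hb)
  inv_mem' a ha b hb := by
    by_cases h0 : a = 0
    · rw [h0, _root_.inv_zero, zero_mul]
      exact zero_mem B
    · have hinj : Function.Injective (fun b : B => (⟨a * b.1, ha _ b.2⟩ : B)) := by
        intro b c hbc
        exact Subtype.ext (mul_left_cancel₀ h0 (congrArg Subtype.val hbc))
      obtain ⟨c, hc⟩ := Finite.surjective_of_injective hinj ⟨b, hb⟩
      have hc : a * c.1 = b := congrArg Subtype.val hc
      rw [← hc, inv_mul_cancel_left₀ h0]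
      exact c.2

variable {H : Type*} [Group H] [MulAction H (OnePoint F)]

/-- If the orbit of a point `y` has one point more than the group `V` of elements fixing only `y`,
and the stabilizer of `y` is large enough, then in suitable coordinates this orbit is the projective
line over a subfield `k` with `|V|` elements, so that `H` preserves this line.

Put `y` at infinity and two other points of the orbit at `0` and `1`. The finite points of the orbit
are the images of `0` under the translations in `V`, so they form an additive subgroup `B`
containing `1`. Its multiplier subfield `k` is contained in `B`, and it contains the `c` multipliers
of the stabilizer of `y`. So `|k| > c`, and `|k|` divides `|V| ≤ 2 * c + 1`, which forces
`k = B`. -/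
theorem ActsByMoebius.exists_subfield [FaithfulSMul H (OnePoint F)] [Finite H]
    (hM : ActsByMoebius F H) {y : OnePoint F} {V : Subgroup H}
    (hV : ∀ h, h ∈ V ↔ h = 1 ∨ fixedBy (OnePoint F) h = {y}) (h3 : 2 ≤ Nat.card V)
    (horb : Nat.card (orbit H y) = Nat.card V + 1) {c : ℕ}
    (hc : Nat.card (stabilizer H y) = Nat.card V * c) (hle : Nat.card V ≤ 2 * c + 1) :
    ∃ (P : GL (Fin 2) F) (k : Subfield F), Nat.card k = Nat.card V ∧
      ∀ (h : H), ∀ x ∈ k.projectivePoints, P • h • P⁻¹ • x ∈ k.projectivePoints := by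
  have hfin : (orbit H y).Finite := Set.finite_range _
  have hdiff : (orbit H y \ {y}).ncard = Nat.card V := by
    have := Set.ncard_sdiff_singleton_add_one (mem_orbit_self (M := H) y) hfin
    rw [← Nat.card_coe_set_eq (orbit H y), horb] at this
    omega
  obtain ⟨y₀, y₁, hy₀, hy₁, h01⟩ :=
    (Set.one_lt_ncard_iff (hfin.subset Set.sdiff_subset)).1 (by rw [hdiff]; omega)
  obtain ⟨P, hP, hP0, hP1⟩ := OnePoint.exists_smul_eq_infty_zero_one hy₀.2 hy₁.2 h01
  obtain ⟨α, β, hαβ⟩ := hM.exists_affine hP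
  have hker := multiplier_eq_one_iff hP hαβ
  have hβeq : ∀ (g : stabilizer H y) (b : F),
      g.1 • P⁻¹ • ((0 : F) : OnePoint F) = P⁻¹ • (b : OnePoint F) → β g = b := by
    intro g b hg
    rw [hαβ] at hg
    have := OnePoint.inv_smul_coe_injective P hg
    linear_combination this
  have hβmul : ∀ g h, β (g * h) = α g * β h + β g := by
    intro g h
    refine hβeq _ _ ?_
    rw [Subgroup.coe_mul, mul_smul, hαβ, hαβ, mul_zero, zero_add]
  have hβone : β 1 = 0 := hβeq 1 0 (by simp)
  -- `T` is the finite part of the orbit, and `B` consists of the lengths of the translations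
  let T : Set F := {x | P⁻¹ • (x : OnePoint F) ∈ orbit H y}
  have hT : T.ncard = Nat.card V := by
    rw [← hdiff, ← Set.ncard_image_of_injective T
      (f := fun x : F => P⁻¹ • (x : OnePoint F))
      fun _ _ h => OnePoint.inv_smul_coe_injective P h]
    congr 1
    ext z
    constructor
    · rintro ⟨x, hx, rfl⟩
      exact ⟨hx, OnePoint.inv_smul_coe_ne hP x⟩
    · rintro ⟨hz, hzy⟩
      obtain ⟨x, rfl⟩ := OnePoint.eq_inv_smul_coe_of_ne hP hzy
      exact ⟨x, hz, rfl⟩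
  have hTfin : T.Finite := Set.finite_of_ncard_ne_zero (by omega)
  let B : AddSubgroup F :=
    { carrier := {b | ∃ v : stabilizer H y, α v = 1 ∧ β v = b}
      zero_mem' := ⟨1, map_one α, hβone⟩
      add_mem' := by
        rintro _ _ ⟨v, hv, rfl⟩ ⟨w, hw, rfl⟩
        exact ⟨w * v, by rw [map_mul, hv, hw, one_mul], by rw [hβmul, hw, one_mul]⟩
      neg_mem' := by
        rintro _ ⟨v, hv, rfl⟩
        have hv' : α v⁻¹ = 1 := by
          have := map_mul α v v⁻¹
          rwa [mul_inv_cancel, map_one, hv, one_mul, eq_comm] at this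
        refine ⟨v⁻¹, hv', ?_⟩
        have := hβmul v v⁻¹
        rw [mul_inv_cancel, hβone, hv, one_mul] at this
        linear_combination -this }
  have hBT : (B : Set F) ⊆ T := by
    rintro _ ⟨v, hv, rfl⟩
    have h0 : P⁻¹ • ((0 : F) : OnePoint F) ∈ orbit H y := by
      rw [← hP0, inv_smul_smul]
      exact hy₀.1
    have h1 := hαβ v 0
    rw [mul_zero, zero_add] at h1
    change P⁻¹ • ((β v : F) : OnePoint F) ∈ orbit H y
    rw [← h1]
    exact mem_orbit_of_mem_orbit _ h0
  have hBfin : Finite B := (hTfin.subset hBT).to_subtype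
  have hVstab : ∀ v ∈ V, ∃ h : v ∈ stabilizer H y, α ⟨v, h⟩ = 1 := by
    intro v hv
    have h1 := (hV v).1 hv
    have hs : v ∈ stabilizer H y := by
      rcases h1 with rfl | h1
      · exact one_mem _
      · have : y ∈ fixedBy (OnePoint F) v := by rw [h1]; rfl
        exact this
    exact ⟨hs, (hker ⟨v, hs⟩).2 (h1.imp Subtype.ext id)⟩
  have hVB : Nat.card V ≤ Nat.card B := by
    refine Nat.card_le_card_of_injective
      (fun v : V => (⟨β ⟨v.1, (hVstab v.1 v.2).1⟩, _, (hVstab v.1 v.2).2, rfl⟩ : B)) ?_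
    intro v w hvw
    have hvw : β ⟨v.1, (hVstab v.1 v.2).1⟩ = β ⟨w.1, (hVstab w.1 w.2).1⟩ :=
      congrArg Subtype.val hvw
    have h1 : w.1⁻¹ * v.1 = 1 := by
      refine eq_one_of_affine hP
        (mul_mem (inv_mem (hVstab w.1 w.2).1) (hVstab v.1 v.2).1 : _ ∈ stabilizer H y) fun x => ?_
      have h2 := hαβ ⟨v.1, (hVstab v.1 v.2).1⟩ x
      have h3 := hαβ ⟨w.1, (hVstab w.1 w.2).1⟩ x
      rw [(hVstab v.1 v.2).2, hvw] at h2
      rw [(hVstab w.1 w.2).2, ← h2] at h3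
      rw [mul_smul, inv_smul_eq_iff]
      exact h3.symm
    exact Subtype.ext (inv_mul_eq_one.1 h1).symm
  have hBTeq : (B : Set F) = T := by
    refine Set.eq_of_subset_of_ncard_le hBT ?_ hTfin
    rw [hT, ← Nat.card_coe_set_eq]
    exact hVB
  have hBcard : Nat.card B = Nat.card V := by
    rw [← hT, ← hBTeq, ← Nat.card_coe_set_eq]
    rfl
  let k := B.multiplierSubfield
  have h1B : (1 : F) ∈ B := by
    rw [← SetLike.mem_coe, hBTeq]
    change P⁻¹ • ((1 : F) : OnePoint F) ∈ orbit H y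
    rw [← hP1, inv_smul_smul]
    exact hy₁.1
  have hkB : k.toSubring.toAddSubgroup ≤ B := by
    intro a ha
    have := ha 1 h1B
    rwa [mul_one] at this
  have hαk : ∀ g, α g ∈ k := by
    rintro g _ ⟨u, hu, rfl⟩
    have h1 : α (g * u * g⁻¹) = 1 := by
      rw [map_mul, map_mul, hu, mul_one, ← map_mul, mul_inv_cancel, map_one]
    refine ⟨g * u * g⁻¹, h1, hβeq _ _ ?_⟩
    rw [smul_conj_translation hαβ hu, zero_add]
  have hkfin : Finite k := Finite.of_injective (fun a : k => (⟨a.1, hkB a.2⟩ : B))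
    fun a b h => Subtype.ext (congrArg (fun x : B => x.1) h)
  have hkdvd : Nat.card k ∣ Nat.card V := by
    rw [← hBcard]
    exact AddSubgroup.card_dvd_of_le hkB
  have hkc : c ≤ Nat.card k - 1 := by
    let γ : stabilizer H y →* kˣ := (α.codRestrict k hαk).toHomUnits
    have hγ : ∀ g, g ∈ γ.ker ↔ α g = 1 := by
      intro g
      rw [MonoidHom.mem_ker, Units.ext_iff, Subtype.ext_iff]
      rfl
    have h1 : Nat.card γ.ker = Nat.card V := by
      refine Nat.card_congr ⟨fun g => ⟨g.1.1, (hV _).2 (((hker g.1).1 ((hγ _).1 g.2)).imp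
        (congrArg Subtype.val) id)⟩, fun v => ⟨⟨v.1, (hVstab v.1 v.2).1⟩,
        (hγ _).2 (hVstab v.1 v.2).2⟩, fun _ => rfl, fun _ => rfl⟩
    have h2 := γ.ker.card_mul_index
    rw [h1, hc] at h2
    rw [← Nat.eq_of_mul_eq_mul_left (by omega) h2, Subgroup.index_ker, ← Nat.card_units]
    exact Subgroup.card_le_card_group _
  have hkcard : Nat.card k = Nat.card V := by
    obtain ⟨m, hm⟩ := hkdvd
    have hpos : 0 < Nat.card k := Nat.card_pos
    have : m < 2 := by
      by_contra! h
      have := Nat.mul_le_mul_left (Nat.card k) h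
      omega
    interval_cases m <;> omega
  have hkBeq : k.toSubring.toAddSubgroup = B := by
    refine AddSubgroup.eq_of_le_of_card_ge hkB ?_
    rw [hBcard, ← hkcard]
    exact le_rfl
  refine ⟨P, k, hkcard, fun h x hx => ?_⟩
  have hxO : P⁻¹ • x ∈ orbit H y := by
    rcases hx with rfl | ⟨a, ha, rfl⟩
    · rw [← hP, inv_smul_smul]
      exact mem_orbit_self y
    · have : a ∈ T := by
        rw [← hBTeq]
        exact hkB ha
      exact this
  have hhO := mem_orbit_of_mem_orbit h hxO
  by_cases hzy : h • P⁻¹ • x = y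
  · left
    rw [hzy, hP]
  · right
    obtain ⟨b, hb⟩ := OnePoint.eq_inv_smul_coe_of_ne hP hzy
    rw [hb] at hhO ⊢
    have hbT : b ∈ T := hhO
    rw [← hBTeq, ← hkBeq] at hbT
    exact ⟨b, hbT, smul_inv_smul P _⟩

end Subline

section ProjectivelyRational

variable {F : Type*} [Field F]

/-- A matrix which is a multiple of one with entries in the subfield `k`. The factor may be zero, so
that the zero matrix is included. -/
def Subfield.IsProjectivelyRational (k : Subfield F) (M : Matrix (Fin 2) (Fin 2) F) : Prop :=
  ∃ (r : F) (N : Matrix (Fin 2) (Fin 2) k), M = r • N.map k.subtype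

namespace Subfield.IsProjectivelyRational

variable {k : Subfield F}

theorem of_entries {M : Matrix (Fin 2) (Fin 2) F} (r : F) (hr : r ≠ 0)
    (h : ∀ i j, M i j / r ∈ k) : k.IsProjectivelyRational M := by
  refine ⟨r, Matrix.of fun i j => ⟨M i j / r, h i j⟩, ?_⟩
  ext i j
  simp [mul_div_cancel₀ _ hr]

/-- A matrix preserving the projective line over `k` is projectively rational over `k`, as its
entries are determined up to a factor by the images of `∞`, `0` and `1`. -/
theorem of_smul_mem [DecidableEq F] {A : GL (Fin 2) F}
    (hA : ∀ x ∈ k.projectivePoints, A • x ∈ k.projectivePoints) :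
    k.IsProjectivelyRational (A : Matrix (Fin 2) (Fin 2) F) := by
  have hcoe : ∀ a : F, ((a : F) : OnePoint F) ∈ k.projectivePoints → a ∈ k := by
    rintro a (h | ⟨b, hb, h⟩)
    · exact absurd h (OnePoint.coe_ne_infty a)
    · rwa [OnePoint.coe_injective h]
  have hi := hA OnePoint.infty (Or.inl rfl)
  have h0 := hA ((0 : F) : OnePoint F) (Or.inr ⟨0, zero_mem k, rfl⟩)
  have h1 := hA ((1 : F) : OnePoint F) (Or.inr ⟨1, one_mem k, rfl⟩)
  rw [OnePoint.smul_infty_eq_ite] at hi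
  rw [OnePoint.smul_some_eq_ite] at h0 h1
  have hdet := A.det_ne_zero
  rw [det_fin_two] at hdet
  simp only [mul_zero, zero_add, mul_one] at h0 h1
  by_cases hc : A 1 0 = 0
  · have hd : A 1 1 ≠ 0 := by
      intro hd
      apply hdet
      rw [hc, hd]
      ring
    rw [if_neg hd] at h0
    rw [if_neg (by rwa [hc, zero_add])] at h1
    have h0 := hcoe _ h0
    have h1 := hcoe _ h1
    rw [hc, zero_add] at h1
    refine of_entries (A 1 1) hd ?_
    simp only [Fin.forall_fin_two, hc, zero_div, div_self hd]
    refine ⟨⟨?_, h0⟩, zero_mem k, one_mem k⟩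
    have := sub_mem h1 h0
    rwa [← sub_div, add_sub_cancel_right] at this
  · rw [if_neg hc] at hi
    have hi := hcoe _ hi
    have key : A 0 1 / A 1 0 ∈ k ∧ A 1 1 / A 1 0 ∈ k := by
      by_cases hd : A 1 1 = 0
      · rw [if_neg (by rwa [hd, add_zero])] at h1
        have h1 := hcoe _ h1
        rw [hd, add_zero] at h1
        rw [hd, zero_div]
        refine ⟨?_, zero_mem k⟩
        have := sub_mem h1 hi
        rwa [← sub_div, add_sub_cancel_left] at this
      · rw [if_neg hd] at h0
        have h0 := hcoe _ h0
        have hdc : A 1 1 / A 1 0 ∈ k := by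
          by_cases hcd : A 1 0 + A 1 1 = 0
          · have : A 1 1 / A 1 0 = -1 := by
              rw [div_eq_iff hc]
              linear_combination hcd
            rw [this]
            exact neg_mem (one_mem k)
          · rw [if_neg hcd] at h1
            have h1 := hcoe _ h1
            set t := (A 0 0 + A 0 1) / (A 1 0 + A 1 1) with ht
            have htm : t * (A 1 0 + A 1 1) = A 0 0 + A 0 1 := div_mul_cancel₀ _ hcd
            have hne : t - A 0 1 / A 1 1 ≠ 0 := by
              intro h
              apply hdet
              have h2 : t * A 1 1 = A 0 1 := by
                rw [sub_eq_zero.1 h, div_mul_cancel₀ _ hd]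
              linear_combination A 1 0 * h2 - A 1 1 * htm + A 1 1 * h2
            have : A 1 1 / A 1 0 = (A 0 0 / A 1 0 - t) / (t - A 0 1 / A 1 1) := by
              rw [eq_div_iff hne]
              field_simp
              linear_combination htm
            rw [this]
            exact div_mem (sub_mem hi h1) (sub_mem h1 h0)
        refine ⟨?_, hdc⟩
        have := mul_mem h0 hdc
        rwa [div_mul_div_cancel₀ hd] at this
    refine of_entries (A 1 0) hc ?_
    simp only [Fin.forall_fin_two, div_self hc]
    exact ⟨⟨hi, key.1⟩, one_mem k, key.2⟩

theorem mul {M N : Matrix (Fin 2) (Fin 2) F} (hM : k.IsProjectivelyRational M)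
    (hN : k.IsProjectivelyRational N) : k.IsProjectivelyRational (M * N) := by
  obtain ⟨r, M, rfl⟩ := hM
  obtain ⟨s, N, rfl⟩ := hN
  refine ⟨r * s, M * N, ?_⟩
  rw [Matrix.map_mul, smul_mul_smul_comm]

theorem smul {M : Matrix (Fin 2) (Fin 2) F} (hM : k.IsProjectivelyRational M) (s : F) :
    k.IsProjectivelyRational (s • M) := by
  obtain ⟨r, M, rfl⟩ := hM
  exact ⟨s * r, M, smul_smul _ _ _⟩

theorem commutator {M N : Matrix (Fin 2) (Fin 2) F} (hM : k.IsProjectivelyRational M)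
    (hN : k.IsProjectivelyRational N) : k.IsProjectivelyRational (M * N - N * M) := by
  obtain ⟨r, M, rfl⟩ := hM
  obtain ⟨s, N, rfl⟩ := hN
  refine ⟨r * s, M * N - N * M, ?_⟩
  rw [Matrix.map_sub _ (map_sub k.subtype), Matrix.map_mul, Matrix.map_mul, smul_mul_smul_comm,
    smul_mul_smul_comm, mul_comm s r, smul_sub]

/-- If `M = r • N` has determinant `1`, then `r² = (det N)⁻¹`, so `(tr M)² = (tr N)² / det N`. -/
theorem trace_sq_mem {M : Matrix (Fin 2) (Fin 2) F} (hM : k.IsProjectivelyRational M)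
    (hdet : M.det = 1) : M.trace ^ 2 ∈ k := by
  obtain ⟨r, N, rfl⟩ := hM
  have h1 : (N.map k.subtype).det = k.subtype N.det := (RingHom.map_det k.subtype N).symm
  have h2 : (N.map k.subtype).trace = k.subtype N.trace := (AddMonoidHom.map_trace k.subtype N).symm
  rw [det_smul, Fintype.card_fin, h1] at hdet
  have hd : k.subtype N.det ≠ 0 := by
    intro h
    rw [h, mul_zero] at hdet
    exact zero_ne_one hdet
  rw [trace_smul, h2, smul_eq_mul, mul_pow, eq_div_of_mul_eq hd hdet, one_div]
  exact mul_mem (inv_mem N.det.2) (pow_mem N.trace.2 2)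

end Subfield.IsProjectivelyRational

end ProjectivelyRational

end

/-! ### Classification of the groups generated by a string triple -/

section

open MulAction Matrix

section Classification

variable {F : Type*} [Field F] [DecidableEq F] {H : Type*} [Group H] [MulAction H (OnePoint F)]
  [FaithfulSMul H (OnePoint F)] [Finite H]

theorem ActsByMoebius.exists_isParabolicSystem [IsAlgClosed F] {p : ℕ} [Fact p.Prime] [CharP F p]
    (hM : ActsByMoebius F H) :
    ∃ U : OnePoint F → Subgroup H, IsParabolicSystem p U ∧ ∀ y,
      (∀ v ∈ U y, v ^ p = 1) ∧
      (∀ a ∈ stabilizer H y, ∀ b ∈ stabilizer H y, a * b * (b * a)⁻¹ ∈ U y) ∧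
      (∀ a ∈ stabilizer H y, ∀ b ∈ stabilizer H y, a ∉ U y → b ∉ U y → a * a = 1 → b * b = 1 →
        a * b ∈ U y) := by
  choose U h1 h2 h3 h4 h5 using hM.exists_parabolic_subgroup (p := p)
  refine ⟨U, ⟨hM.ncard_fixedBy, h1, fun y hy => ?_, h3⟩, fun y => ⟨h2 y, h4 y, h5 y⟩⟩
  obtain ⟨⟨v, hv⟩, hv1⟩ := Subgroup.ne_bot_iff_exists_ne_one.1 hy
  have h6 : orderOf v = p := orderOf_eq_prime (h2 y v hv) fun h => hv1 (Subtype.ext h)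
  rw [← h6]
  exact Subgroup.orderOf_dvd_natCard _ hv

end Classification

theorem eq_one_of_mul_self_of_pow {G : Type*} [Group G] {p : ℕ} (hp : p.Prime) (hp2 : p ≠ 2)
    {z : G} (hz : z * z = 1) (hzp : z ^ p = 1) : z = 1 := by
  rw [← orderOf_eq_one_iff]
  refine Nat.eq_one_of_dvd_coprimes ((Nat.coprime_primes Nat.prime_two hp).2 hp2.symm) ?_ ?_
  · exact orderOf_dvd_of_pow_eq_one ((pow_two z).trans hz)
  · exact orderOf_dvd_of_pow_eq_one hzp

namespace IsParabolicSystem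

variable {H X : Type*} [Group H] [MulAction H X] {p : ℕ} {U : X → Subgroup H}

/-- The centralizer of an involution `z` permutes the two fixed points of `z`; an element of it
fixing both is outside `U y` or trivial, and the stabilizer of `y` has order `2 * |U y|`. -/
theorem card_centralizer_le [Finite H] (hU : IsParabolicSystem p U) {z : H}
    (hz1 : z ≠ 1) (hz : z * z = 1) (hzU : ∀ y, z ∉ U y)
    (heven : ∀ y : X, 2 ∣ Nat.card (stabilizer H y) →
      Nat.card (stabilizer H y) = 2 * Nat.card (U y) ∧ Odd (Nat.card (U y))) :
    Nat.card (Subgroup.centralizer {z}) ≤ 4 := by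
  have h2 : (fixedBy X z).ncard = 2 := by
    refine (hU.ncard_fixedBy z hz1).resolve_left fun h1 => ?_
    obtain ⟨y, hy⟩ := Set.ncard_eq_one.1 h1
    exact hzU y ((hU.mem_iff y z).2 (Or.inr hy))
  obtain ⟨y, y', hyy', hfix⟩ := Set.ncard_eq_two.1 h2
  have hzy : z ∈ stabilizer H y := by
    have : y ∈ fixedBy X z := by rw [hfix]; simp
    exact this
  have hperm : ∀ c ∈ Subgroup.centralizer {z}, ∀ x ∈ fixedBy X z, c • x ∈ fixedBy X z := by
    intro c hc x hx
    rw [Subgroup.mem_centralizer_singleton_iff] at hc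
    rw [mem_fixedBy] at hx ⊢
    rw [← mul_smul, ← hc, mul_smul, hx]
  have hy : y ∈ fixedBy X z := hzy
  have hy' : y' ∈ fixedBy X z := by rw [hfix]; simp
  have horb : Nat.card (orbit (Subgroup.centralizer {z}) y) ≤ 2 := by
    rw [Nat.card_coe_set_eq, ← h2]
    refine Set.ncard_le_ncard ?_ (Set.finite_of_ncard_ne_zero (by omega))
    rintro _ ⟨c, rfl⟩
    exact hperm c.1 c.2 y hy
  have hcard : Nat.card (stabilizer H y) = 2 * Nat.card (U y) := by
    refine (heven y ?_).1
    have : orderOf z = 2 := orderOf_eq_prime (by rw [pow_two, hz]) hz1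
    rw [← this]
    exact Subgroup.orderOf_dvd_natCard _ hzy
  have hstab : Nat.card (stabilizer (Subgroup.centralizer {z}) y) ≤ 2 := by
    have hfix' : ∀ c : stabilizer (Subgroup.centralizer {z}) y, c.1.1 • y' = y' := by
      intro c
      have h1 := hperm c.1.1 c.1.2 y' hy'
      rw [hfix] at h1
      rcases h1 with h1 | h1
      · have h3 : c.1.1 • y = y := c.2
        exact absurd (smul_left_cancel _ (h1.trans h3.symm)).symm hyy'
      · exact h1
    have hinj : Function.Injective
        (fun a : stabilizer (Subgroup.centralizer {z}) y × U y =>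
          (⟨a.1.1.1 * a.2.1, mul_mem (s := stabilizer H y) a.1.2 (hU.le_stabilizer y a.2.2)⟩ :
            stabilizer H y)) := by
      rintro ⟨c, v⟩ ⟨d, w⟩ h
      have h1 : c.1.1 * v.1 = d.1.1 * w.1 := congrArg Subtype.val h
      have h3 : d.1.1⁻¹ * c.1.1 = w.1 * v.1⁻¹ := by
        rw [eq_mul_inv_iff_mul_eq, mul_assoc, h1, inv_mul_cancel_left]
      have h4 : d.1.1⁻¹ * c.1.1 = 1 := by
        refine hU.eq_one_of_smul_eq hyy'.symm
          (h3 ▸ mul_mem w.2 (inv_mem v.2) : d.1.1⁻¹ * c.1.1 ∈ U y) ?_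
        rw [mul_smul, hfix' c, inv_smul_eq_iff, hfix' d]
      have h5 : c.1.1 = d.1.1 := (inv_mul_eq_one.1 h4).symm
      have h6 : v.1 = w.1 := by
        rw [h5] at h1
        exact mul_left_cancel h1
      exact Prod.ext (Subtype.ext (Subtype.ext h5)) (Subtype.ext h6)
    have h1 := Nat.card_le_card_of_injective _ hinj
    rw [Nat.card_prod, hcard] at h1
    exact Nat.le_of_mul_le_mul_right h1 Nat.card_pos
  rw [← card_orbit_mul_card_stabilizer (H := Subgroup.centralizer {z}) y]
  exact Nat.mul_le_mul horb hstab

/-- Two involutions fix points in a common orbit, so a conjugate of the first fixes the same point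
as the second. Their product is then in `U y`, hence of odd order, so they are conjugate in the
dihedral group that they generate. -/
theorem exists_conj_eq_of_involutions (hU : IsParabolicSystem p U) {z w : H}
    (hz1 : z ≠ 1) (hz : z * z = 1) (hw1 : w ≠ 1) (hw : w * w = 1)
    (hinv : ∀ y, ∀ a : H, a ≠ 1 → a * a = 1 → a ∉ U y)
    (hmul : ∀ y, ∀ a ∈ stabilizer H y, ∀ b ∈ stabilizer H y, a ∉ U y → b ∉ U y → a * a = 1 →
      b * b = 1 → a * b ∈ U y)
    (heven : ∀ y : X, 2 ∣ Nat.card (stabilizer H y) →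
      Nat.card (stabilizer H y) = 2 * Nat.card (U y) ∧ Odd (Nat.card (U y)))
    (horb : ∀ y x : X, 2 ∣ Nat.card (stabilizer H y) → 2 ∣ Nat.card (stabilizer H x) →
      x ∈ orbit H y) : ∃ g, g * z * g⁻¹ = w := by
  have hfix : ∀ a : H, a ≠ 1 → ∃ y : X, a ∈ stabilizer H y := by
    intro a ha
    have h1 : (fixedBy X a).Nonempty := by
      apply Set.nonempty_of_ncard_ne_zero
      rcases hU.ncard_fixedBy a ha with h | h <;> omega
    exact h1
  have hdvd : ∀ a : H, a ≠ 1 → a * a = 1 → ∀ y : X, a ∈ stabilizer H y →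
      2 ∣ Nat.card (stabilizer H y) := by
    intro a ha1 ha y hay
    have : orderOf a = 2 := orderOf_eq_prime (by rw [pow_two, ha]) ha1
    rw [← this]
    exact Subgroup.orderOf_dvd_natCard _ hay
  obtain ⟨y, hzy⟩ := hfix z hz1
  obtain ⟨x, hwx⟩ := hfix w hw1
  obtain ⟨g, rfl⟩ := horb y x (hdvd z hz1 hz y hzy) (hdvd w hw1 hw x hwx)
  have hz'1 : g * z * g⁻¹ ≠ 1 := by simpa using hz1
  have hz' : g * z * g⁻¹ * (g * z * g⁻¹) = 1 := by
    calc _ = g * (z * z) * g⁻¹ := by group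
      _ = 1 := by rw [hz]; group
  have hz'y : g * z * g⁻¹ ∈ stabilizer H (g • y) := by
    have : z • y = y := hzy
    simp [mem_stabilizer_iff, mul_smul, this]
  have h1 : g * z * g⁻¹ * w ∈ U (g • y) :=
    hmul _ _ hz'y _ hwx (hinv _ _ hz'1 hz') (hinv _ _ hw1 hw) hz' hw
  obtain ⟨f, hf⟩ := exists_conj_eq_of_odd_orderOf_mul hz' hw
    ((heven _ (hdvd w hw1 hw _ hwx)).2.of_dvd_nat (Subgroup.orderOf_dvd_natCard _ h1))
  exact ⟨f * g, by rw [← hf]; group⟩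

end IsParabolicSystem

/-- A string triple with `s * t` of odd order does not exist in a group with an abelian subgroup `S`
of index two: `s * t` is in `S`, and so is one of the involutions `s`, `u`, `s * u`, which would
then commute with `s` and `t`. -/
theorem IsStringTriple.false_of_index_two {H : Type*} [Group H] {s t u : H}
    (h : IsStringTriple s t u) (hodd : Odd (orderOf (s * t))) {S : Subgroup H}
    (hS : S.index = 2) (hcomm : ∀ a ∈ S, ∀ b ∈ S, Commute a b) : False := by
  have hr : s * t ∈ S := by
    obtain ⟨k, hk⟩ := hodd
    have h1 : s * t = ((s * t) * (s * t)) ^ (k + 1) := by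
      rw [← pow_two, ← pow_mul, show 2 * (k + 1) = orderOf (s * t) + 1 by omega, pow_succ,
        pow_orderOf_eq_one, one_mul]
    rw [h1]
    exact pow_mem (Subgroup.mul_self_mem_of_index_two hS _) _
  by_cases hs : s ∈ S
  · exact h.left_ne_one (h.eq_one_of_commute s h.mul_self_left (Commute.refl s)
      (h.commute_mid (Commute.refl s) (hcomm s hs _ hr)))
  · by_cases hu : u ∈ S
    · exact h.not_commute_right (hcomm u hu _ hr)
    · exact h.not_commute_mul
        (hcomm _ ((Subgroup.mul_mem_iff_of_index_two hS).2 (iff_of_false hs hu)) _ hr)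

/-- A finite group of Möbius transformations in odd characteristic generated by a string triple
`s, t, u` with `s * t` of odd order is isomorphic to `S₄` or to `A₅`, or else it is, up to
conjugation, a group of Möbius transformations over a subfield `k` which has at least the order of
`PSL₂(k)`. -/
theorem IsStringTriple.classification {F : Type*} [Field F] [DecidableEq F] [IsAlgClosed F] {p : ℕ}
    [Fact p.Prime] [CharP F p] (hp2 : p ≠ 2) {H : Type*} [Group H] [Finite H]
    [MulAction H (OnePoint F)] [FaithfulSMul H (OnePoint F)] (hM : ActsByMoebius F H) {s t u : H}
    (h : IsStringTriple s t u) (hgen : Subgroup.closure {s, t, u} = ⊤)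
    (hodd : Odd (orderOf (s * t))) :
    Nonempty (H ≃* Equiv.Perm (Fin 4)) ∨ Nonempty (H ≃* alternatingGroup (Fin 5)) ∨
      ∃ (P : GL (Fin 2) F) (k : Subfield F), Finite k ∧
        (∀ (h : H), ∀ x ∈ k.projectivePoints, P • h • P⁻¹ • x ∈ k.projectivePoints) ∧
        (Nat.card k + 1) * Nat.card k * (Nat.card k - 1) ≤ 2 * Nat.card H := by
  have hp : p.Prime := Fact.out
  have hp3 : 3 ≤ p := by
    have := hp.two_le
    omega
  obtain ⟨U, hU, hUy⟩ := hM.exists_isParabolicSystem (p := p)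
  have hinv : ∀ y, ∀ a : H, a ≠ 1 → a * a = 1 → a ∉ U y := fun y a ha1 ha haU =>
    ha1 (eq_one_of_mul_self_of_pow hp hp2 ha ((hUy y).1 a haU))
  have hmul := fun y => (hUy y).2.2
  have hntriv : Nontrivial H := ⟨⟨s, 1, h.left_ne_one⟩⟩
  -- with a global fixed point `y`, the involution `s * u` would be in `U y`, which has exponent `p`
  have htop : ∀ y : OnePoint F, stabilizer H y ≠ ⊤ := by
    intro y hy
    have hmem : ∀ a : H, a ∈ stabilizer H y := fun a => hy ▸ Subgroup.mem_top a
    exact hinv y _ h.mul_ne_one h.mul_mul_self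
      (hmul y s (hmem s) u (hmem u) (hinv y s h.left_ne_one h.mul_self_left)
        (hinv y u h.right_ne_one h.mul_self_right) h.mul_self_left h.mul_self_right)
  have hthree : ∀ n, Nat.card H = n → (∀ m, m ∣ n → Odd m → m = 1 ∨ m = 3) →
      orderOf (s * t) = 3 := by
    intro n hn hm
    refine (hm _ (hn ▸ orderOf_dvd_natCard _) hodd).resolve_left fun h1 => ?_
    rw [orderOf_eq_one_iff] at h1
    apply h.not_commute_right
    rw [h1]
    exact Commute.one_right u
  have hsixty : Nat.card H = 60 → (∀ y : OnePoint F, 2 ∣ Nat.card (stabilizer H y) →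
        Nat.card (stabilizer H y) = 2 * Nat.card (U y) ∧ Odd (Nat.card (U y))) →
      (∀ y x : OnePoint F, 2 ∣ Nat.card (stabilizer H y) → 2 ∣ Nat.card (stabilizer H x) →
        x ∈ orbit H y) → Nonempty (H ≃* alternatingGroup (Fin 5)) := by
    intro hH heven horb
    exact nonempty_mulEquiv_alternatingGroup h hgen hH
      (fun z hz1 hz => hU.card_centralizer_le hz1 hz (fun y => hinv y z hz1 hz) heven)
      fun z w hz1 hz hw1 hw =>
        hU.exists_conj_eq_of_involutions hz1 hz hw1 hw hinv hmul heven horb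
  by_cases htame : ∀ y, U y = ⊥
  · rcases hU.classification_of_tame htame with ⟨y, hy⟩ | ⟨y, hy⟩ | hH | hH | ⟨hH, he, ho⟩
    · exact absurd hy (htop y)
    · exfalso
      refine h.false_of_index_two hodd (S := stabilizer H y) ?_ fun a ha b hb => ?_
      · have h1 := (stabilizer H y).card_mul_index
        rw [← hy, mul_comm 2] at h1
        exact Nat.eq_of_mul_eq_mul_left Nat.card_pos h1
      · have h1 := (hUy y).2.1 a ha b hb
        rw [htame y, Subgroup.mem_bot, mul_inv_eq_one] at h1
        exact h1
    · refine absurd hH (h.card_ne_twelve (hthree 12 hH fun m hm ho => ?_))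
      have := Nat.le_of_dvd (by norm_num) hm
      interval_cases m <;> revert hm ho <;> decide
    · refine Or.inl (h.nonempty_mulEquiv_perm (hthree 24 hH fun m hm ho => ?_) hH)
      have := Nat.le_of_dvd (by norm_num) hm
      interval_cases m <;> revert hm ho <;> decide
    · refine Or.inr (Or.inl (hsixty hH (fun y hy => ?_) ho))
      rw [he y hy, htame y, Subgroup.card_bot]
      exact ⟨rfl, odd_one⟩
  · obtain ⟨y₀, hy₀⟩ := not_forall.1 htame
    rcases hU.classification_of_wild hp3 hy₀ with
      ⟨y, hy⟩ | ⟨hH, he, ho⟩ | ⟨y, hy, horb, c, hc, hle⟩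
    · exact absurd hy (htop y)
    · exact Or.inr (Or.inl (hsixty hH he ho))
    · right; right
      have h2 : 2 ≤ Nat.card (U y) := (U y).one_lt_card_iff_ne_bot.2 hy
      obtain ⟨P, k, hk, hPk⟩ := hM.exists_subfield (hU.mem_iff y) h2 horb hc hle
      refine ⟨P, k, Nat.finite_of_card_ne_zero (by omega), hPk, ?_⟩
      rw [hk, ← card_orbit_mul_card_stabilizer (H := H) y, horb, hc]
      have : Nat.card (U y) - 1 ≤ 2 * c := by omega
      calc _ ≤ (Nat.card (U y) + 1) * Nat.card (U y) * (2 * c) := Nat.mul_le_mul_left _ this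
        _ = _ := by ring

end

/-! ### Facet groups of string representations -/

section

open MulAction Matrix
open scoped MatrixGroups

namespace Matrix.ProjectiveSpecialLinearGroup

variable {K F : Type*} [Field K] [Field F] [Algebra K F]

variable (K F) in
/-- The action of `PSL₂(K)` on the projective line over an extension field `F`. -/
noncomputable def moebiusHom [DecidableEq F] : PSL(2, K) →* Equiv.Perm (OnePoint F) :=
  QuotientGroup.lift (Subgroup.center SL(2, K))
    ((toPermHom (GL (Fin 2) F) (OnePoint F)).comp (SpecialLinearGroup.mapGL F)) <| by
    intro A hA
    obtain ⟨r, hr, h⟩ := SpecialLinearGroup.mem_center_iff.1 hA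
    have hr0 : algebraMap K F r ≠ 0 := by
      intro h0
      rw [(map_eq_zero _).1 h0] at hr
      simp at hr
    ext x
    rw [MonoidHom.comp_apply, toPermHom_apply, toPerm_apply, Equiv.Perm.one_apply]
    induction x using OnePoint.rec with
    | infty =>
      rw [OnePoint.smul_infty_eq_self_iff]
      simp [SpecialLinearGroup.mapGL_coe_matrix, ← h]
    | coe x =>
      rw [OnePoint.smul_some_eq_ite]
      simp [SpecialLinearGroup.mapGL_coe_matrix, ← h, hr0]

theorem moebiusHom_mk [DecidableEq F] (A : SL(2, K)) (x : OnePoint F) :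
    moebiusHom K F (QuotientGroup.mk A) x = SpecialLinearGroup.mapGL F A • x :=
  rfl

theorem moebiusHom_injective [DecidableEq F] : Function.Injective (moebiusHom K F) := by
  rw [injective_iff_map_eq_one]
  intro g hg
  obtain ⟨A, rfl⟩ := QuotientGroup.mk_surjective g
  have h : ∀ x : OnePoint F, SpecialLinearGroup.mapGL F A • x = x := fun x => by
    rw [← moebiusHom_mk, hg, Equiv.Perm.one_apply]
  have hdet := A.det_coe
  rw [det_fin_two] at hdet
  have hc : A.1 1 0 = 0 := by
    have := OnePoint.smul_infty_eq_self_iff.1 (h OnePoint.infty)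
    simpa [SpecialLinearGroup.mapGL_coe_matrix] using this
  have hd : A.1 1 1 ≠ 0 := by
    intro hd
    rw [hc, hd] at hdet
    simp at hdet
  have h0 := h ((0 : F) : OnePoint F)
  have h1 := h ((1 : F) : OnePoint F)
  rw [OnePoint.smul_some_eq_ite] at h0 h1
  simp [SpecialLinearGroup.mapGL_coe_matrix, hc, hd] at h0 h1
  have ha : A.1 0 0 = A.1 1 1 := by
    rw [h0, map_zero, add_zero, div_eq_one_iff_eq (by simpa using hd)] at h1
    exact (algebraMap K F).injective h1
  have hsq : A.1 1 1 * A.1 1 1 = 1 := by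
    rw [h0, ha] at hdet
    linear_combination hdet
  refine (mk_eq_mk_iff A 1).2 ?_
  rcases mul_self_eq_one_iff.1 hsq with h4 | h4
  · left
    ext i j
    fin_cases i <;> fin_cases j <;> simp [h4, h0, hc, ha]
  · right
    ext i j
    fin_cases i <;> fin_cases j <;> simp [h4, h0, hc, ha]

/-- The element `g` of `PSL₂(K)` has a lift to `SL₂(K)` which, viewed over the extension field `F`
and conjugated by `P`, is a multiple of a matrix over the subfield `k`. -/
def IsRational (P : GL (Fin 2) F) (k : Subfield F) (g : PSL(2, K)) : Prop :=
  ∃ A : SL(2, K), QuotientGroup.mk A = g ∧ k.IsProjectivelyRational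
    (P * SpecialLinearGroup.mapGL F A * P⁻¹ : GL (Fin 2) F).1

theorem IsRational.one (P : GL (Fin 2) F) (k : Subfield F) : IsRational (K := K) P k 1 := by
  refine ⟨1, rfl, 1, 1, ?_⟩
  rw [map_one, mul_one, mul_inv_cancel]
  simp

theorem IsRational.mul {P : GL (Fin 2) F} {k : Subfield F} {g h : PSL(2, K)}
    (hg : IsRational P k g) (hh : IsRational P k h) : IsRational P k (g * h) := by
  obtain ⟨A, rfl, hA⟩ := hg
  obtain ⟨B, rfl, hB⟩ := hh
  refine ⟨A * B, rfl, ?_⟩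
  have : P * SpecialLinearGroup.mapGL F (A * B) * P⁻¹ =
      (P * SpecialLinearGroup.mapGL F A * P⁻¹) * (P * SpecialLinearGroup.mapGL F B * P⁻¹) := by
    rw [map_mul]
    group
  rw [this]
  exact hA.mul hB

theorem isProjectivelyRational_of_smul_mem [DecidableEq F] {P : GL (Fin 2) F} {k : Subfield F}
    {A : SL(2, K)} (h : ∀ x ∈ k.projectivePoints,
      P • moebiusHom K F (QuotientGroup.mk A) (P⁻¹ • x) ∈ k.projectivePoints) :
    k.IsProjectivelyRational (P * SpecialLinearGroup.mapGL F A * P⁻¹ : GL (Fin 2) F).1 := by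
  refine Subfield.IsProjectivelyRational.of_smul_mem fun x hx => ?_
  rw [mul_smul, mul_smul]
  exact h x hx

/-- An involution commuting with two rational non-commuting involutions is rational, as it lifts to
a multiple of their commutator. -/
theorem isRational_of_commute (h2 : (2 : K) ≠ 0) {P : GL (Fin 2) F} {k : Subfield F}
    {g h z : PSL(2, K)} (hg : g * g = 1) (hh : h * h = 1) (hz : z * z = 1) (hz1 : z ≠ 1)
    (hgh : ¬ Commute g h) (hzg : Commute z g) (hzh : Commute z h) (hgk : IsRational P k g)
    (hhk : IsRational P k h) : IsRational P k z := by
  have hg1 : g ≠ 1 := by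
    rintro rfl
    exact hgh (Commute.one_left _)
  have hh1 : h ≠ 1 := by
    rintro rfl
    exact hgh (Commute.one_right _)
  have hzg' : z ≠ g := by
    rintro rfl
    exact hgh hzh
  have hzh' : z ≠ h := by
    rintro rfl
    exact hgh hzg.symm
  obtain ⟨A, rfl, hA⟩ := hgk
  obtain ⟨B, rfl, hB⟩ := hhk
  obtain ⟨Z, rfl⟩ := QuotientGroup.mk_surjective z
  have tA := trace_eq_zero_of_mul_self hg1 hg
  have tB := trace_eq_zero_of_mul_self hh1 hh
  have tZ := trace_eq_zero_of_mul_self hz1 hz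
  obtain ⟨r, hr⟩ := exists_eq_smul_commutator h2 tZ (mul_ne_mul_of_not_commute hgh)
    (mul_eq_neg_mul_of_commute h2 tZ tA hzg' hzg) (mul_eq_neg_mul_of_commute h2 tZ tB hzh' hzh)
  refine ⟨Z, rfl, ?_⟩
  have hmap : (SpecialLinearGroup.mapGL F Z).1 = algebraMap K F r •
      ((SpecialLinearGroup.mapGL F A).1 * (SpecialLinearGroup.mapGL F B).1 -
        (SpecialLinearGroup.mapGL F B).1 * (SpecialLinearGroup.mapGL F A).1) := by
    simp only [SpecialLinearGroup.mapGL_coe_matrix, SpecialLinearGroup.map_apply_coe, hr,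
      RingHom.mapMatrix_apply]
    ext i j
    simp [Matrix.mul_apply]
  have hPP : P⁻¹.1 * P.1 = 1 := by
    rw [← Units.val_mul, inv_mul_cancel, Units.val_one]
  have hconj : (P * SpecialLinearGroup.mapGL F Z * P⁻¹ : GL (Fin 2) F).1 = algebraMap K F r •
      ((P * SpecialLinearGroup.mapGL F A * P⁻¹ : GL (Fin 2) F).1 *
        (P * SpecialLinearGroup.mapGL F B * P⁻¹ : GL (Fin 2) F).1 -
        (P * SpecialLinearGroup.mapGL F B * P⁻¹ : GL (Fin 2) F).1 *
        (P * SpecialLinearGroup.mapGL F A * P⁻¹ : GL (Fin 2) F).1) := by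
    have key : ∀ M N : Matrix (Fin 2) (Fin 2) F,
        (P.1 * M * P⁻¹.1) * (P.1 * N * P⁻¹.1) = P.1 * (M * N) * P⁻¹.1 := by
      intro M N
      calc _ = P.1 * M * (P⁻¹.1 * P.1) * N * P⁻¹.1 := by simp only [mul_assoc]
        _ = _ := by rw [hPP, mul_one]; simp only [mul_assoc]
    simp only [Units.val_mul, key, hmap, mul_smul_comm, smul_mul_assoc, mul_sub, sub_mul]
  rw [hconj]
  exact (hA.commutator hB).smul _

/-- If all of `PSL₂(K)` is rational over `k`, then `K` is contained in `k`, because the squares of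
the traces of its elements are in `k`. -/
theorem card_le_of_forall_isRational (h2 : (2 : K) ≠ 0) {P : GL (Fin 2) F} {k : Subfield F}
    [Finite k] (h : ∀ g : PSL(2, K), IsRational P k g) : Nat.card K ≤ Nat.card k := by
  have hsq : ∀ t : K, algebraMap K F t ^ 2 ∈ k := by
    intro t
    obtain ⟨T, hT⟩ : ∃ T : SL(2, K), T.1 = !![t, -1; 1, 0] := ⟨⟨_, by simp [det_fin_two]⟩, rfl⟩
    obtain ⟨A, hA, hAk⟩ := h (QuotientGroup.mk T)
    have h1 := hAk.trace_sq_mem (by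
      rw [Units.val_mul, Units.val_mul, det_mul_right_comm, ← Units.val_mul, mul_inv_cancel,
        Units.val_one, one_mul]
      exact congrArg Units.val (SpecialLinearGroup.det_mapGL (S := F) A))
    rw [Units.val_mul, trace_mul_comm, ← Units.val_mul, ← mul_assoc, inv_mul_cancel, one_mul,
      trace_fin_two, SpecialLinearGroup.mapGL_coe_matrix] at h1
    rw [mk_eq_mk_iff, hT] at hA
    convert h1 using 1
    rcases hA with hA | hA <;> simp [hA]
  have h2F : (2 : F) ≠ 0 := by
    rw [← map_ofNat (algebraMap K F)]
    simpa using h2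
  have hmem : ∀ t : K, algebraMap K F t ∈ k := by
    intro t
    have : algebraMap K F t = (algebraMap K F (t + 1) ^ 2 - algebraMap K F t ^ 2 - 1) / 2 := by
      rw [eq_div_iff h2F, map_add, map_one]
      ring
    rw [this]
    exact div_mem (sub_mem (sub_mem (hsq _) (hsq _)) (one_mem k)) (ofNat_mem k 2)
  exact Nat.card_le_card_of_injective (fun t : K => (⟨algebraMap K F t, hmem t⟩ : k))
    fun a b hab => (algebraMap K F).injective (congrArg (fun x : k => x.1) hab)

end Matrix.ProjectiveSpecialLinearGroup

namespace IsStringRepresentation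

open Matrix.ProjectiveSpecialLinearGroup

variable {K G : Type*} [Field K] [Group G] {ρ : Fin 4 → G}

theorem mul_self {n : ℕ} {ρ : Fin n → G} (hρ : IsStringRepresentation ρ) (i : Fin n) :
    ρ i * ρ i = 1 := by
  rw [← pow_two, ← hρ.orderOf_eq_two i, pow_orderOf_eq_one]

theorem ne_one {n : ℕ} {ρ : Fin n → G} (hρ : IsStringRepresentation ρ) (i : Fin n) : ρ i ≠ 1 := by
  intro h
  have := hρ.orderOf_eq_two i
  rw [h, orderOf_one] at this
  omega

/-- The reversed tuple, which exchanges vertex and facet groups. -/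
theorem rev (hρ : IsStringRepresentation ρ) : IsStringRepresentation (ρ ∘ Fin.rev) where
  orderOf_eq_two i := hρ.orderOf_eq_two _
  injective := hρ.injective.comp Fin.rev_injective
  commute i j h := hρ.commute _ _ (by
    rw [Fin.val_rev, Fin.val_rev]
    convert h using 1
    rw [← abs_neg]
    congr 1
    omega)
  closure_eq_top := by
    rw [Set.range_comp, Fin.rev_surjective.range_eq, Set.image_univ]
    exact hρ.closure_eq_top

/-- Otherwise `ρ 0` would commute with all generators, but `PSL₂(K)` has trivial centre. -/
theorem not_commute_zero_one (hρ : IsStringRepresentation ρ) (e : G ≃* PSL(2, K)) :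
    ¬ Commute (ρ 0) (ρ 1) := by
  intro h01
  have h1 : ∀ g : G, Commute (ρ 0) g := by
    intro g
    have hg : g ∈ Subgroup.closure (Set.range ρ) := hρ.closure_eq_top ▸ Subgroup.mem_top g
    induction hg using Subgroup.closure_induction with
    | mem x hx =>
      obtain ⟨i, rfl⟩ := hx
      fin_cases i
      · exact Commute.refl _
      · exact h01
      · exact hρ.commute 0 2 (by decide)
      · exact hρ.commute 0 3 (by decide)
    | one => exact Commute.one_right _
    | mul x y _ _ hx hy => exact hx.mul_right hy
    | inv x _ hx => exact hx.inv_right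
  obtain ⟨A, hA⟩ := QuotientGroup.mk_surjective (e (ρ 0))
  have h2 : e (ρ 0) = 1 := by
    rw [← hA]
    refine eq_one_of_forall_commute fun B => ?_
    have := (h1 (e.symm (QuotientGroup.mk B))).map e
    rw [MulEquiv.apply_symm_apply, ← hA] at this
    exact this
  exact hρ.ne_one 0 (e.map_eq_one_iff.1 h2)

/-- In characteristic two commuting is transitive on non-trivial elements, and `ρ 3` commutes with
`ρ 0` and `ρ 1`, which do not commute. -/
theorem two_ne_zero (hρ : IsStringRepresentation ρ) (e : G ≃* PSL(2, K)) : (2 : K) ≠ 0 := by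
  intro h2
  apply hρ.not_commute_zero_one e
  have h30 : Commute (ρ 3) (ρ 0) := hρ.commute 3 0 (by decide)
  have h31 : Commute (ρ 3) (ρ 1) := hρ.commute 3 1 (by decide)
  have := commute_of_commute_of_char_two h2 (z := e (ρ 3))
    (fun h => hρ.ne_one 3 (e.map_eq_one_iff.1 h)) (h30.map e) (h31.map e)
  simpa using this.map e.symm

/-- `ρ 3` is the only involution commuting with `ρ 0` and `ρ 1`. -/
theorem eq_three (hρ : IsStringRepresentation ρ) (e : G ≃* PSL(2, K)) {z : G} (hz1 : z ≠ 1)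
    (hz : z * z = 1) (hz0 : Commute z (ρ 0)) (hz1' : Commute z (ρ 1)) : z = ρ 3 := by
  have hsq : ∀ x : G, x * x = 1 → e x * e x = 1 := fun x hx => by rw [← map_mul, hx, map_one]
  have h30 : Commute (ρ 3) (ρ 0) := hρ.commute 3 0 (by decide)
  have h31 : Commute (ρ 3) (ρ 1) := hρ.commute 3 1 (by decide)
  refine e.injective (eq_of_commute_of_commute (hρ.two_ne_zero e) (hsq _ (hρ.mul_self 0))
    (hsq _ (hρ.mul_self 1)) (hsq z hz) (hsq _ (hρ.mul_self 3))
    (fun h => hz1 (e.map_eq_one_iff.1 h)) (fun h => hρ.ne_one 3 (e.map_eq_one_iff.1 h))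
    (fun h => hρ.not_commute_zero_one e (by simpa using h.map e.symm)) (hz0.map e) (hz1'.map e)
    (h30.map e) (h31.map e))

theorem mem_faceGroup_three {i : Fin 4} (hi : i ≠ 3) : ρ i ∈ faceGroup ρ 3 :=
  Subgroup.subset_closure ⟨i, hi, rfl⟩

theorem faceGroup_three_eq_top (hρ : IsStringRepresentation ρ) (h : ρ 3 ∈ faceGroup ρ 3) :
    faceGroup ρ 3 = ⊤ := by
  rw [eq_top_iff, ← hρ.closure_eq_top, Subgroup.closure_le]
  rintro _ ⟨i, rfl⟩
  by_cases hi : i = 3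
  · rw [hi]
    exact h
  · exact mem_faceGroup_three hi

/-- If the facet group is proper, then `ρ 0 * ρ 1` has odd order, since otherwise `ρ 3` would be a
power of it. -/
theorem odd_orderOf_mul (hρ : IsStringRepresentation ρ) [Finite G] (e : G ≃* PSL(2, K))
    (h : ρ 3 ∉ faceGroup ρ 3) : Odd (orderOf (ρ 0 * ρ 1)) := by
  rw [← Nat.not_even_iff_odd]
  rintro ⟨n, hn⟩
  have hpos : 0 < orderOf (ρ 0 * ρ 1) := orderOf_pos _
  -- if the order is even, the involution in the cyclic group is central in the dihedral group
  have hz1 : (ρ 0 * ρ 1) ^ n ≠ 1 := pow_ne_one_of_lt_orderOf (by omega) (by omega)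
  have hz : (ρ 0 * ρ 1) ^ n * (ρ 0 * ρ 1) ^ n = 1 := by
    rw [← pow_add, ← hn, pow_orderOf_eq_one]
  have hz0 : Commute ((ρ 0 * ρ 1) ^ n) (ρ 0) := by
    have := (semiconjBy_inv_of_mul_self (hρ.mul_self 0) (hρ.mul_self 1)).pow_right n
    rw [inv_pow, inv_eq_of_mul_eq_one_left hz] at this
    exact Commute.symm this
  have hz01 : Commute ((ρ 0 * ρ 1) ^ n) (ρ 1) := by
    have h1 : ρ 1 = ρ 0 * (ρ 0 * ρ 1) := by rw [← mul_assoc, hρ.mul_self, one_mul]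
    nth_rw 2 [h1]
    exact hz0.mul_right (Commute.pow_left (Commute.refl _) n)
  apply h
  rw [← hρ.eq_three e hz1 hz hz0 hz01]
  exact pow_mem (mul_mem (mem_faceGroup_three (by decide)) (mem_faceGroup_three (by decide))) n

theorem isStringTriple (hρ : IsStringRepresentation ρ) (e : G ≃* PSL(2, K))
    (h : ρ 3 ∉ faceGroup ρ 3) :
    IsStringTriple (⟨ρ 0, mem_faceGroup_three (by decide)⟩ : faceGroup ρ 3)
      ⟨ρ 1, mem_faceGroup_three (by decide)⟩ ⟨ρ 2, mem_faceGroup_three (by decide)⟩ where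
  mul_self_left := Subtype.ext (hρ.mul_self 0)
  mul_self_mid := Subtype.ext (hρ.mul_self 1)
  mul_self_right := Subtype.ext (hρ.mul_self 2)
  left_ne_one h := hρ.ne_one 0 (congrArg Subtype.val h)
  mid_ne_one h := hρ.ne_one 1 (congrArg Subtype.val h)
  right_ne_one h := hρ.ne_one 2 (congrArg Subtype.val h)
  left_ne_right h := absurd (hρ.injective (congrArg Subtype.val h)) (by decide)
  comm := Subtype.ext (hρ.commute 0 2 (by decide))
  eq_one_of_commute z hz h0 h1 := by
    by_contra hz1
    have hz3 : z.1 = ρ 3 := hρ.eq_three e (fun h => hz1 (Subtype.ext h))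
      (congrArg Subtype.val hz) (congrArg Subtype.val h0) (congrArg Subtype.val h1)
    exact h (hz3 ▸ z.2)

theorem faceGroup_three_cases [Finite K] (hρ : IsStringRepresentation ρ) (e : G ≃* PSL(2, K)) :
    Nonempty (faceGroup ρ 3 ≃* Equiv.Perm (Fin 4)) ∨
      Nonempty (faceGroup ρ 3 ≃* alternatingGroup (Fin 5)) ∨
      Nonempty (faceGroup ρ 3 ≃* G) := by
  classical
  by_cases h3 : ρ 3 ∈ faceGroup ρ 3
  · right; right
    rw [hρ.faceGroup_three_eq_top h3]
    exact ⟨Subgroup.topEquiv⟩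
  have : Finite SL(2, K) := Subtype.finite
  have : Finite G := Finite.of_equiv _ e.symm.toEquiv
  have h2 := hρ.two_ne_zero e
  obtain ⟨p, hp⟩ := CharP.exists K
  have : Fact p.Prime := ⟨CharP.char_is_prime K p⟩
  let F := AlgebraicClosure K
  have : CharP F p := charP_of_injective_algebraMap (algebraMap K F).injective p
  have hp2 : p ≠ 2 := by
    rintro rfl
    exact h2 (by exact_mod_cast CharP.cast_eq_zero K 2)
  let φ : G →* Equiv.Perm (OnePoint F) := (moebiusHom K F).comp e.toMonoidHom
  have hφ : Function.Injective φ := moebiusHom_injective.comp e.injective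
  let _ : MulAction G (OnePoint F) := MulAction.compHom _ φ
  have hsmul : ∀ (g : G) (x : OnePoint F), g • x = moebiusHom K F (e g) x := fun _ _ => rfl
  have : FaithfulSMul G (OnePoint F) := ⟨fun h => hφ (Equiv.ext h)⟩
  have hM : ActsByMoebius F (faceGroup ρ 3) := by
    intro h
    obtain ⟨A, hA⟩ := QuotientGroup.mk_surjective (e h)
    refine ⟨SpecialLinearGroup.mapGL F A, fun x => ?_⟩
    rw [Subgroup.smul_def, hsmul, ← hA, moebiusHom_mk]
  have htriple := hρ.isStringTriple e h3
  have hgen : Subgroup.closure {(⟨ρ 0, mem_faceGroup_three (by decide)⟩ : faceGroup ρ 3),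
      ⟨ρ 1, mem_faceGroup_three (by decide)⟩, ⟨ρ 2, mem_faceGroup_three (by decide)⟩} = ⊤ := by
    refine Eq.trans ?_
      (Subgroup.closure_closure_coe_preimage (k := {g : G | ∃ j : Fin 4, j ≠ 3 ∧ ρ j = g}))
    congr 1
    ext ⟨x, hx⟩
    simp only [Set.mem_insert_iff, Set.mem_singleton_iff, Subtype.mk.injEq]
    constructor
    · rintro (rfl | rfl | rfl)
      exacts [⟨0, by decide, rfl⟩, ⟨1, by decide, rfl⟩, ⟨2, by decide, rfl⟩]
    · rintro ⟨i, hi, rfl⟩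
      fin_cases i <;> simp at hi ⊢
  have hodd := hρ.odd_orderOf_mul e h3
  rcases htriple.classification hp2 hM hgen (by rwa [← Subgroup.orderOf_coe]) with
    h | h | ⟨P, k, hk, hPk, hcard⟩
  · exact Or.inl h
  · exact Or.inr (Or.inl h)
  · exfalso
    -- the facet group is rational over `k`, hence so are `ρ 3` and the group `G`; by order the
    -- facet group is `G`
    have hrat : ∀ i, i ≠ 3 → IsRational P k (e (ρ i)) := by
      intro i hi
      obtain ⟨A, hA⟩ := QuotientGroup.mk_surjective (e (ρ i))
      refine ⟨A, hA, isProjectivelyRational_of_smul_mem fun x hx => ?_⟩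
      rw [hA]
      exact hPk ⟨ρ i, mem_faceGroup_three hi⟩ x hx
    have hsq : ∀ i, e (ρ i) * e (ρ i) = 1 := fun i => by rw [← map_mul, hρ.mul_self, map_one]
    have h30 : Commute (ρ 3) (ρ 0) := hρ.commute 3 0 (by decide)
    have h31 : Commute (ρ 3) (ρ 1) := hρ.commute 3 1 (by decide)
    have hrat3 : IsRational P k (e (ρ 3)) :=
      isRational_of_commute h2 (hsq 0) (hsq 1) (hsq 3)
        (fun h => hρ.ne_one 3 (e.map_eq_one_iff.1 h))
        (fun h => hρ.not_commute_zero_one e (by simpa using h.map e.symm)) (h30.map e) (h31.map e)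
        (hrat 0 (by decide)) (hrat 1 (by decide))
    have hall : ∀ g : G, IsRational P k (e g) := by
      intro g
      have hg : g ∈ Submonoid.closure (Set.range ρ) := by
        rw [← Subgroup.closure_toSubmonoid_of_finite, hρ.closure_eq_top]
        exact Subgroup.mem_top g
      induction hg using Submonoid.closure_induction with
      | mem x hx =>
        obtain ⟨i, rfl⟩ := hx
        by_cases hi : i = 3
        · rw [hi]
          exact hrat3
        · exact hrat i hi
      | one =>
        rw [map_one]
        exact IsRational.one P k
      | mul x y _ _ hx hy =>
        rw [map_mul]
        exact hx.mul hy
    have hKk : Nat.card K ≤ Nat.card k :=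
      card_le_of_forall_isRational h2 fun g => by simpa using hall (e.symm g)
    have hG : 2 * Nat.card G ≤ 2 * Nat.card (faceGroup ρ 3) := by
      rw [Nat.card_congr e.toEquiv]
      refine (two_mul_card_le h2).trans (le_trans ?_ hcard)
      exact Nat.mul_le_mul (Nat.mul_le_mul (by omega) hKk) (by omega)
    have htop : faceGroup ρ 3 = ⊤ := Subgroup.eq_top_of_le_card _ (by omega)
    exact h3 (htop ▸ Subgroup.mem_top _)

theorem faceGroup_zero_eq (ρ : Fin 4 → G) : faceGroup ρ 0 = faceGroup (ρ ∘ Fin.rev) 3 := by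
  unfold faceGroup
  congr 1
  ext g
  constructor
  · rintro ⟨j, hj, rfl⟩
    exact ⟨j.rev, fun h => hj (by rw [← Fin.rev_rev j, h]; rfl), by simp⟩
  · rintro ⟨j, hj, rfl⟩
    exact ⟨j.rev, fun h => hj (by rw [← Fin.rev_rev j, h]; rfl), rfl⟩

end IsStringRepresentation

end

/-- `K` is a finite field of order `q`, so `Matrix.ProjectiveSpecialLinearGroup (Fin 2) K` is
`PSL₂(q)`. -/
theorem theorem3p9 (q : ℕ) (K : Type*) [Field K] [Finite K] (hK : Nat.card K = q)
    (G : Type*) [Group G] (hG : Nonempty (G ≃* Matrix.ProjectiveSpecialLinearGroup (Fin 2) K))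
    (ρ : Fin 4 → G) (hρ : IsStringRepresentation ρ) :
    (Nonempty (faceGroup ρ 3 ≃* Equiv.Perm (Fin 4)) ∨
      Nonempty (faceGroup ρ 3 ≃* alternatingGroup (Fin 5)) ∨
      Nonempty (faceGroup ρ 3 ≃* G)) ∧
    (Nonempty (faceGroup ρ 0 ≃* Equiv.Perm (Fin 4)) ∨
      Nonempty (faceGroup ρ 0 ≃* alternatingGroup (Fin 5)) ∨
      Nonempty (faceGroup ρ 0 ≃* G)) := by
  obtain ⟨e⟩ := hG
  refine ⟨hρ.faceGroup_three_cases e, ?_⟩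
  rw [IsStringRepresentation.faceGroup_zero_eq]
  exact hρ.rev.faceGroup_three_cases e
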